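/- Let $\mathbb R^+=(0,\infty)$ and let $\{X_{n,j}: n\ge 1,\ 1\le j\le n\}$ be a triangular array of $\mathbb R^+$-valued random variables (each row $X_{n,1},\dots,X_{n,n}$ is defined on a probability space, which may depend on $n$) such that each row is stationary: for $m+h\le n$, the vectors $(X_{n,1},\dots,X_{n,m})$ and $(X_{n,1+h},\dots,X_{n,m+h})$ have the same law. Let $\lambda$ be a locally finite measure on $\mathbb R^+$ that is absolutely continuous with respect to Lebesgue measure. Suppose that for every finite union $I\subset\mathbb R^+$ of (bounded or unbounded) open intervals with $\lambda(I)<\infty$ the following three conditions hold. 1. $n\,\mathbf P(X_{n,1}\in I)\to\lambda(I)$ as $n\to\infty$. 2. There exists $\varepsilon>0$ such that $\mathbf P(X_{n,i}\in I,\ X_{n,j}\in I)=o\big(n^{-(1+\varepsilon)}\big)$ as $n\to\infty$, uniformly in $1\le i<j\le n$. 3. There exist $\theta\in(0,1)$ and $C>0$ such that for all $k,n,q\in\mathbb N$ with $2q+k\le n$, $$\Big|\mathbf P\big(X_{n,1}\in I^c,\dots,X_{n,q}\in I^c,\ X_{n,q+k+1}\in I^c,\dots,X_{n,2q+k}\in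 I^c\big)-\mathbf P\big(X_{n,1}\in I^c,\dots,X_{n,q}\in I^c\big)^2\Big|\le C\theta^k .$$ A Poisson random measure with intensity $\lambda$ is a random locally finite measure $N$ on $\mathbb R^+$ that is independently scattered (its values on finitely many pairwise disjoint Borel sets are independent) and such that $N(B)$ has the Poisson distribution with parameter $\lambda(B)$ for every Borel set $B$ with $\lambda(B)<\infty$. Then a Poisson random measure $N$ with intensity $\lambda$ exists, and for any such $N$ $$\sum_{j=1}^n\delta_{X_{n,j}}\ \Longrightarrow\ N\qquad(n\to\infty)$$ weakly (in distribution) as random elements of the space of locally finite measures on $\mathbb R^+$ with the vague topology, i.e. the coarsest topology making $\mu\mapsto\int f\,d\mu$ continuous for every continuous, compactly supported $f:\mathbb R^+\to\mathbb R$. -/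

import Mathlib

open MeasureTheory ProbabilityTheory Filter Topology
open scoped ENNReal NNReal CompactlySupported

/-- The state space `(0, ∞)`, with the topology, order and Borel sets
induced from `ℝ`. -/
abbrev PosHalfLine : Type := Set.Ioi (0 : ℝ)

/-- Locally finite measures on `E` (for `E = (0, ∞)` these are the Radon measures). -/
structure LocFinMeasure (E : Type*) [TopologicalSpace E] [MeasurableSpace E] where
  toMeasure : Measure E
  isLocallyFinite : IsLocallyFiniteMeasure toMeasure

namespace LocFinMeasure

variable {E : Type*} [TopologicalSpace E] [MeasurableSpace E]

/-- The vague topology: the coarsest topology for which `μ ↦ ∫ f dμ` is continuous for every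
continuous compactly supported `f : E → ℝ`. -/
noncomputable instance : TopologicalSpace (LocFinMeasure E) :=
  TopologicalSpace.induced
    (fun (μ : LocFinMeasure E) (f : C_c(E, ℝ)) => ∫ x, f x ∂μ.toMeasure) inferInstance

/-- The Borel sets of the vague topology. -/
noncomputable instance : MeasurableSpace (LocFinMeasure E) := borel _

instance : BorelSpace (LocFinMeasure E) := ⟨rfl⟩

end LocFinMeasure

/-- `I` is a finite union of open intervals contained in `(0, ∞)`; an open interval (bounded or
not, possibly empty) is an open order-connected set. -/
def IsFiniteUnionOpenIntervals (I : Set PosHalfLine) : Prop :=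
  ∃ F : Set (Set PosHalfLine), F.Finite ∧ (∀ J ∈ F, IsOpen J ∧ J.OrdConnected) ∧ I = ⋃₀ F

/-- The row `Y 1, …, Y n` is stationary: for all `m + h ≤ n` the vectors `(Y 1, …, Y m)` and
`(Y (1 + h), …, Y (m + h))` have the same law. -/
def IsStationaryRow {Ω E : Type*} [MeasurableSpace Ω] [MeasurableSpace E]
    (n : ℕ) (Y : ℕ → Ω → E) (P : Measure Ω) : Prop :=
  ∀ m h : ℕ, m + h ≤ n →
    IdentDistrib (fun ω (i : Fin m) => Y (i + 1) ω) (fun ω (i : Fin m) => Y (i + 1 + h) ω) P P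

/-- The empirical point process `∑_{j=1}^n δ_{Y j}`. -/
noncomputable def empiricalProcess {Ω E : Type*} [TopologicalSpace E] [MeasurableSpace E]
    (n : ℕ) (Y : ℕ → Ω → E) (ω : Ω) : LocFinMeasure E where
  toMeasure := ∑ j ∈ Finset.Icc 1 n, Measure.dirac (Y j ω)
  isLocallyFinite := inferInstance

/-- The random measure `N`, defined on the probability space `(Ω, P)`, is a Poisson random measure
with intensity `lam`: it is independently scattered, and `N(B)` is Poisson distributed with
parameter `lam(B)` for every Borel set `B` with `lam(B) < ∞`. -/
structure IsPoissonRandomMeasure {Ω E : Type*} [MeasurableSpace Ω]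
    [TopologicalSpace E] [MeasurableSpace E]
    (lam : Measure E) (N : Ω → LocFinMeasure E) (P : Measure Ω) : Prop where
  measurable : Measurable N
  indep : ∀ (m : ℕ) (B : Fin m → Set E), (∀ i, MeasurableSet (B i)) →
    Pairwise (fun i j => Disjoint (B i) (B j)) →
    iIndepFun (fun i ω => (N ω).toMeasure (B i)) P
  law : ∀ B : Set E, MeasurableSet B → lam B < ∞ →
    HasLaw (fun ω => (N ω).toMeasure B)
      ((poissonMeasure (lam B).toNNReal).map (Nat.cast : ℕ → ℝ≥0∞)) P

/-! A point process limit without fixed atoms is determined by which small intervals are empty, and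
the means rule out multiple points. So it suffices to show, for finite unions I of open intervals
with finite intensity, that the void probabilities tend to exp(-λ(I)) and the means tend to λ(I).
The means are immediate from stationarity and condition 1.

For the void probabilities (`tendsto_voidProb`), the row is halved repeatedly, a gap of length k
being discarded at each halving. Condition 3 makes the void probability of a block nearly the square
of that of its half, with error Cθ^k plus kp for the gap, where p = P(X_{n,1} ∈ I). After m halvings
the void probability of the row is close to the 2^m-th power of that of a short block. Condition 2
and inclusion-exclusion bring the short block close to exp(-p · length), and the product tends to
exp(-λ(I)).

To pass to weak convergence (`tendstoInDistribution_of_void`), the vague topology is induced by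
countably many test integrals, so finite-dimensional distributions suffice. The supports of finitely
many test functions are cut into cells of small intensity. Unless a cell carries two points or an
end point is hit, each integral is nearly a sum over occupied cells. The bad event is controlled by
E(N(J) - 1 + 1{N(J) = 0}), which has order λ(J)² in the limit. The remaining functional depends only
on the joint emptiness of cells, that is, on void probabilities of unions. Absolute continuity
enters only through λ having no atoms.

Existence (`exists_isPoissonRandomMeasure`) superposes independent Poisson samples on disjoint
pieces of finite mass; a joint characteristic function gives laws and independence on each piece. -/

/-! ### Vague topology: countable generation and a weak convergence criterion -/

section VagueTopology

variable {E : Type*} [TopologicalSpace E]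

attribute [instance] LocFinMeasure.isLocallyFinite

namespace LocFinMeasure

theorem continuous_integral [MeasurableSpace E] (f : C_c(E, ℝ)) :
    Continuous fun μ : LocFinMeasure E => ∫ x, f x ∂μ.toMeasure :=
  (continuous_apply f).comp (continuous_induced_dom
    (f := fun (μ : LocFinMeasure E) (f : C_c(E, ℝ)) => ∫ x, f x ∂μ.toMeasure))

theorem exists_cutoff [T2Space E] [LocallyCompactSpace E] {K U : Set E} (hK : IsCompact K)
    (hU : IsOpen U) (hKU : K ⊆ U) :
    ∃ g : C_c(E, ℝ), (∀ x ∈ K, g x = 1) ∧ (∀ x ∉ U, g x = 0) ∧ ∀ x, 0 ≤ g x ∧ g x ≤ 1 := by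
  obtain ⟨f, h1, h0, hc, h⟩ := exists_continuous_one_zero_of_isCompact hK hU.isClosed_compl
    (Set.disjoint_compl_right_iff_subset.2 hKU)
  exact ⟨⟨f, hc⟩, fun x hx => h1 hx, fun x hx => h0 hx, fun x => h x⟩

theorem exists_seq_cutoff [T2Space E] [LocallyCompactSpace E] [SigmaCompactSpace E] :
    ∃ g : ℕ → C_c(E, ℝ), (∀ j x, 0 ≤ g j x ∧ g j x ≤ 1) ∧
      ∀ K : Set E, IsCompact K → ∃ j, ∀ x ∈ K, g j x = 1 := by
  have key (j : ℕ) := exists_cutoff ((CompactExhaustion.choice E).isCompact j) isOpen_univ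
    (Set.subset_univ _)
  choose g h1 _ hg using key
  refine ⟨g, hg, fun K hK => ?_⟩
  obtain ⟨j, hj⟩ := (CompactExhaustion.choice E).exists_superset_of_isCompact hK
  exact ⟨j, fun x hx => h1 j x (hj hx)⟩

/-- Product of a compactly supported function with a continuous one. -/
def mulRight (g : C_c(E, ℝ)) (d : C(E, ℝ)) : C_c(E, ℝ) :=
  ⟨⟨fun x => g x * d x, by fun_prop⟩, g.hasCompactSupport.mul_right⟩

/-- The vague topology is generated by countably many test functions. -/
theorem exists_isInducing [T2Space E] [LocallyCompactSpace E] [SecondCountableTopology E]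
    [MeasurableSpace E] [BorelSpace E] :
    ∃ F : ℕ × Option ℕ → C_c(E, ℝ),
      IsInducing (fun (μ : LocFinMeasure E) i => ∫ x, F i x ∂μ.toMeasure) := by
  obtain ⟨g, hg, hgK⟩ := exists_seq_cutoff (E := E)
  let D : ℕ → C(E, ℝ) := TopologicalSpace.denseSeq C(E, ℝ)
  have hD : DenseRange D := TopologicalSpace.denseRange_denseSeq C(E, ℝ)
  -- The index `none` gives the cutoff itself, whose integral bounds the local mass near a given
  -- measure; the indices `some l` approximate a test function uniformly on the support of the
  -- cutoff.
  refine ⟨fun i => i.2.elim (g i.1) fun l => mulRight (g i.1) (D l), ⟨?_⟩⟩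
  set F : ℕ × Option ℕ → C_c(E, ℝ) := fun i => i.2.elim (g i.1) fun l => mulRight (g i.1) (D l)
    with hF
  refine le_antisymm ?_ ?_
  · exact continuous_iff_le_induced.1 (continuous_pi fun i => continuous_integral _)
  · refine continuous_iff_le_induced.1 ?_
    refine @continuous_pi _ _ _ (_) _ _ fun f => ?_
    set T := TopologicalSpace.induced
      (fun (μ : LocFinMeasure E) i => ∫ x, F i x ∂μ.toMeasure) inferInstance
    have hcont (i) : @Continuous _ _ T _ fun μ : LocFinMeasure E => ∫ x, F i x ∂μ.toMeasure :=
      (continuous_apply i).comp (continuous_induced_dom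
        (f := fun (μ : LocFinMeasure E) i => ∫ x, F i x ∂μ.toMeasure))
    refine @continuous_iff_continuousAt _ _ T _ _ |>.2 fun μ₀ => ?_
    rw [@ContinuousAt, Metric.tendsto_nhds]
    intro ε hε
    obtain ⟨j, hj⟩ := hgK _ f.hasCompactSupport
    set c : ℝ := ∫ x, g j x ∂μ₀.toMeasure with hc
    have hc0 : 0 ≤ c := integral_nonneg fun x => (hg j x).1
    -- On the neighbourhood where the cutoff integrates to less than c + 1, the approximation error
    -- is at most η(c + 1) = ε/4.
    set η : ℝ := ε / (4 * (c + 1)) with hη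
    have hη0 : 0 < η := by positivity
    obtain ⟨d, hd⟩ : ∃ l, ∀ x ∈ tsupport (g j), |f x - D l x| < η := by
      have hK : IsCompact (tsupport (g j)) := (g j).hasCompactSupport
      have hopen : IsOpen {h : C(E, ℝ) | Set.MapsTo (h - f.toContinuousMap) (tsupport (g j))
          (Metric.ball 0 η)} :=
        (ContinuousMap.isOpen_setOfPred_mapsTo hK Metric.isOpen_ball).preimage
          (continuous_id.sub continuous_const)
      obtain ⟨l, hl⟩ := hD.exists_mem_open hopen ⟨f.toContinuousMap, fun x _ => by simpa using hη0⟩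
      refine ⟨l, fun x hx => ?_⟩
      have := hl hx
      rw [abs_sub_comm]
      simpa [Real.dist_eq] using this
    have key (μ : LocFinMeasure E) : |∫ x, f x ∂μ.toMeasure - ∫ x, F (j, some d) x ∂μ.toMeasure|
        ≤ η * ∫ x, g j x ∂μ.toMeasure := by
      rw [← integral_sub f.integrable (F (j, some d)).integrable, ← integral_const_mul]
      refine (abs_integral_le_integral_abs).trans (integral_mono_of_nonneg
        (ae_of_all _ fun x => abs_nonneg _) ((g j).integrable.const_mul _) (ae_of_all _ fun x => ?_))
      have hFx : F (j, some d) x = g j x * D d x := rfl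
      have hfx : f x = g j x * f x := by
        by_cases hx : x ∈ tsupport f
        · rw [hj x hx, one_mul]
        · rw [image_eq_zero_of_notMem_tsupport hx, mul_zero]
      show |f x - F (j, some d) x| ≤ η * g j x
      rw [hFx, hfx, ← mul_sub, abs_mul, abs_of_nonneg (hg j x).1, mul_comm]
      by_cases hx : x ∈ tsupport (g j)
      · exact mul_le_mul_of_nonneg_right (hd x hx).le (hg j x).1
      · simp [image_eq_zero_of_notMem_tsupport hx]
    have e1 := (hcont (j, none)).tendsto μ₀ |>.eventually (gt_mem_nhds (lt_add_one c))
    have e2 := Metric.tendsto_nhds.1 ((hcont (j, some d)).tendsto μ₀) (ε / 2) (half_pos hε)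
    filter_upwards [e1, e2] with μ h1 h2
    rw [Real.dist_eq] at h2 ⊢
    have k1 := key μ
    have k2 := key μ₀
    have h1' : η * ∫ x, g j x ∂μ.toMeasure ≤ η * (c + 1) := by
      refine mul_le_mul_of_nonneg_left ?_ hη0.le
      exact h1.le
    have h3 : η * c < η * (c + 1) := by nlinarith
    have h4 : η * (c + 1) = ε / 4 := by rw [hη]; field_simp
    rw [abs_le] at k1 k2
    rw [abs_lt] at h2 ⊢
    constructor <;> linarith [h2.1, h2.2, k1.1, k1.2, k2.1, k2.2]

end LocFinMeasure

/-- On a space whose topology is induced by countably many real functions, weak convergence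
follows from the weak convergence of finite-dimensional distributions. -/
theorem tendsto_probabilityMeasure_of_isInducing_pi {S ι : Type*} [TopologicalSpace S]
    [MeasurableSpace S] [OpensMeasurableSpace S] [Countable ι] {Φ : S → ι → ℝ} (hΦ : IsInducing Φ)
    {μs : ℕ → ProbabilityMeasure S} {μ : ProbabilityMeasure S}
    (h : ∀ (s : Finset ι) (L : (s → ℝ) → ℝ), (∃ C : ℝ, ∀ x y, dist (L x) (L y) ≤ C) →
      (∃ K, LipschitzWith K L) → Tendsto (fun n => ∫ x, L (s.restrict (Φ x)) ∂(μs n : Measure S))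
        atTop (𝓝 (∫ x, L (s.restrict (Φ x)) ∂(μ : Measure S)))) :
    Tendsto μs atTop (𝓝 μ) := by
  refine tendsto_of_forall_isOpen_le_liminf_nat' fun G hG => ?_
  obtain ⟨G', hG', rfl⟩ := hΦ.isOpen_iff.1 hG
  -- G is the directed union of the preimages of the `V s`, so its measure is a supremum and the
  -- portmanteau inequality can be checked for one finite set of coordinates at a time.
  let V (s : Finset ι) : Set (s → ℝ) := interior {y | ∀ z : ι → ℝ, s.restrict z = y → z ∈ G'}
  let r (s : Finset ι) (x : S) : s → ℝ := s.restrict (Φ x)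
  have hr (s) : Continuous (r s) := by
    have : Continuous (s.restrict : (ι → ℝ) → (s → ℝ)) := by fun_prop
    exact this.comp hΦ.continuous
  have hun : Φ ⁻¹' G' = ⋃ s, r s ⁻¹' (V s) := by
    ext x
    simp only [Set.mem_preimage, Set.mem_iUnion]
    constructor
    · intro hx
      obtain ⟨I, u, hu, hI⟩ := isOpen_pi_iff.1 hG' _ hx
      refine ⟨I, mem_interior.2 ⟨Set.univ.pi fun i : I => u i, ?_, ?_, ?_⟩⟩
      · rintro y hy z rfl
        exact hI fun i hi => hy ⟨i, hi⟩ trivial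
      · exact isOpen_set_pi Set.finite_univ fun i _ => (hu i i.2).1
      · exact fun i _ => (hu i i.2).2
    · rintro ⟨s, hs⟩
      exact interior_subset hs _ rfl
  have hdir : Directed (· ⊆ ·) fun s => r s ⁻¹' (V s) := by
    classical
    have hmono : Monotone fun s => r s ⁻¹' (V s) := by
      intro s t hst x hx
      have hc : Continuous (Finset.restrict₂ (π := fun _ => ℝ) hst : (t → ℝ) → (s → ℝ)) :=
        continuous_pi fun i => continuous_apply (⟨i, hst i.2⟩ : t)
      have hsub : Finset.restrict₂ (π := fun _ => ℝ) hst ⁻¹' (V s) ⊆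
          {y : t → ℝ | ∀ z : ι → ℝ, t.restrict z = y → z ∈ G'} := by
        rintro y hy z rfl
        exact interior_subset hy z rfl
      exact interior_maximal hsub (isOpen_interior.preimage hc) hx
    exact hmono.directed_le
  rw [hun, hdir.measure_iUnion]
  refine iSup_le fun s => ?_
  have hmap : Tendsto (fun n => (μs n).map (hr s).measurable.aemeasurable) atTop
      (𝓝 (μ.map (hr s).measurable.aemeasurable)) := by
    refine tendsto_iff_forall_lipschitz_integral_tendsto.2 fun L hb hL => ?_
    have hLm : Measurable L := hL.choose_spec.continuous.measurable
    simp only [ProbabilityMeasure.toMeasure_map]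
    simp_rw [integral_map (hr s).measurable.aemeasurable hLm.aestronglyMeasurable]
    exact h s L hb hL
  have := ProbabilityMeasure.le_liminf_measure_open_of_tendsto hmap
    (isOpen_interior : IsOpen (V s))
  simp only [ProbabilityMeasure.toMeasure_map] at this
  simp_rw [Measure.map_apply (hr s).measurable isOpen_interior.measurableSet] at this
  refine this.trans (liminf_le_liminf (Eventually.of_forall fun n => ?_))
  exact measure_mono (Set.subset_iUnion (fun s => r s ⁻¹' (V s)) s)

end VagueTopology

/-! ### Measurability for the Borel sets of the vague topology -/

section VagueMeasurability

namespace LocFinMeasure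

variable {E : Type*} [TopologicalSpace E] [T2Space E] [LocallyCompactSpace E]
  [SecondCountableTopology E] [MeasurableSpace E] [BorelSpace E]

/-- An open set is σ-compact, so its mass is the supremum of integrals of cutoffs squeezed between
indicators of compact subsets and that of G; these integrals are vaguely continuous. -/
theorem measurable_apply_of_isOpen {G : Set E} (hG : IsOpen G) :
    Measurable fun μ : LocFinMeasure E => μ.toMeasure G := by
  have hGl : LocallyCompactSpace G := hG.locallyCompactSpace
  obtain ⟨K, hK, hKG⟩ : IsSigmaCompact G := isSigmaCompact_iff_sigmaCompactSpace.2 inferInstance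
  have hKsub (j) : Set.accumulate K j ⊆ G := by
    rw [← hKG]; exact Set.accumulate_subset_iUnion j
  have hKc (j) : IsCompact (Set.accumulate K j) := isCompact_accumulate hK j
  choose f h1 h0 hf using fun j => exists_cutoff (hKc j) hG (hKsub j)
  have key (μ : LocFinMeasure E) :
      μ.toMeasure G = ⨆ j, ENNReal.ofReal (∫ x, f j x ∂μ.toMeasure) := by
    have hint (j) : ENNReal.ofReal (∫ x, f j x ∂μ.toMeasure)
        = ∫⁻ x, ENNReal.ofReal (f j x) ∂μ.toMeasure :=
      ofReal_integral_eq_lintegral_ofReal (f j).integrable (ae_of_all _ fun x => (hf j x).1)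
    refine le_antisymm ?_ (iSup_le fun j => ?_)
    · calc μ.toMeasure G = μ.toMeasure (⋃ j, Set.accumulate K j) := by
            rw [Set.iUnion_accumulate, hKG]
        _ = ⨆ j, μ.toMeasure (Set.accumulate K j) :=
            Set.monotone_accumulate.measure_iUnion
        _ ≤ _ := iSup_mono fun j => by
            rw [hint, ← lintegral_indicator_one (hKc j).measurableSet]
            refine lintegral_mono fun x => ?_
            by_cases hx : x ∈ Set.accumulate K j
            · simp [hx, h1 j x hx]
            · simp [hx]
    · rw [hint, ← lintegral_indicator_one hG.measurableSet]
      refine lintegral_mono fun x => ?_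
      by_cases hx : x ∈ G
      · simpa [hx] using (hf j x).2
      · simp [hx, h0 j x hx]
  simp_rw [key]
  exact Measurable.iSup fun j => (continuous_integral (f j)).measurable.ennreal_ofReal

/-- Evaluations on Borel sets are Borel measurable for the vague topology. -/
theorem measurable_toMeasure :
    Measurable (LocFinMeasure.toMeasure : LocFinMeasure E → Measure E) := by
  -- Restricting to relatively compact open sets makes the measures finite, so that the π-system of
  -- open sets decides measurability.
  let W := fun j => interior (CompactExhaustion.choice E j)
  have hWo (j) : IsOpen (W j) := isOpen_interior
  have hWm : Monotone W := fun i j h => interior_mono ((CompactExhaustion.choice E).subset h)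
  have hWu : ⋃ j, W j = Set.univ := by
    refine Set.eq_univ_of_forall fun x => Set.mem_iUnion.2 ?_
    obtain ⟨j, hj⟩ := (CompactExhaustion.choice E).exists_mem x
    exact ⟨j + 1, (CompactExhaustion.choice E).subset_interior_succ j hj⟩
  have hr (j) : Measurable fun μ : LocFinMeasure E => μ.toMeasure.restrict (W j) := by
    have : ∀ μ : LocFinMeasure E, IsFiniteMeasure (μ.toMeasure.restrict (W j)) := fun μ =>
      ⟨by
        rw [Measure.restrict_apply_univ]
        exact (measure_mono interior_subset).trans_lt
          ((CompactExhaustion.choice E).isCompact j).measure_lt_top⟩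
    refine Measurable.measure_of_isPiSystem (S := {s | IsOpen s}) BorelSpace.measurable_eq isPiSystem_isOpen (fun s hs => ?_) ?_
    · simp_rw [Measure.restrict_apply (IsOpen.measurableSet hs)]
      exact measurable_apply_of_isOpen (IsOpen.inter hs (hWo j))
    · simp_rw [Measure.restrict_apply_univ]
      exact measurable_apply_of_isOpen (hWo j)
  refine Measure.measurable_of_measurable_coe _ fun s hs => ?_
  have key (μ : LocFinMeasure E) : μ.toMeasure s = ⨆ j, μ.toMeasure.restrict (W j) s := by
    have hm : Monotone fun j => s ∩ W j := fun i j h => Set.inter_subset_inter_right _ (hWm h)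
    simp_rw [Measure.restrict_apply hs, ← hm.measure_iUnion, ← Set.inter_iUnion, hWu, Set.inter_univ]
  simp_rw [key]
  exact Measurable.iSup fun j => (Measure.measurable_coe hs).comp (hr j)

theorem measurable_integral_of_measurable {Ω : Type*} [MeasurableSpace Ω] {N : Ω → Measure E}
    (hN : Measurable N) [∀ ω, IsLocallyFiniteMeasure (N ω)] (f : C_c(E, ℝ)) :
    Measurable fun ω => ∫ x, f x ∂N ω := by
  have hf : Measurable f := f.continuous.measurable
  simp_rw [fun ω => integral_eq_lintegral_pos_part_sub_lintegral_neg_part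
    (f.integrable (μ := N ω))]
  have h1 := (Measure.measurable_lintegral hf.ennreal_ofReal).comp hN
  have h2 := (Measure.measurable_lintegral hf.neg.ennreal_ofReal).comp hN
  exact h1.ennreal_toReal.sub h2.ennreal_toReal

/-- Countability of the inducing family matters: the Borel sets of a countable power of ℝ are
generated by coordinates, so measurability of the individual integrals suffices. -/
theorem measurable_of_toMeasure {Ω : Type*} [MeasurableSpace Ω] {N : Ω → LocFinMeasure E}
    (hN : Measurable fun ω => (N ω).toMeasure) : Measurable N := by
  obtain ⟨F, hF⟩ := exists_isInducing (E := E)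
  refine measurable_of_isOpen fun G hG => ?_
  obtain ⟨G', hG', rfl⟩ := hF.isOpen_iff.1 hG
  have : Measurable fun ω i => ∫ x, F i x ∂(N ω).toMeasure :=
    measurable_pi_lambda _ fun i => measurable_integral_of_measurable hN (F i)
  exact this hG'.measurableSet

end LocFinMeasure

/-- The Poisson property depends only on the law of N, so any construction can be moved to the
canonical space of measures. -/
theorem IsPoissonRandomMeasure.id_map {E Ω : Type*} [TopologicalSpace E] [T2Space E]
    [LocallyCompactSpace E] [SecondCountableTopology E] [MeasurableSpace E] [BorelSpace E]
    [MeasurableSpace Ω] {lam : Measure E} {N : Ω → LocFinMeasure E} {P : Measure Ω}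
    (h : IsPoissonRandomMeasure lam N P) : IsPoissonRandomMeasure lam id (P.map N) where
  measurable := measurable_id
  indep m B hB hd := by
    have hm (i) : Measurable fun μ : LocFinMeasure E => μ.toMeasure (B i) :=
      (Measure.measurable_coe (hB i)).comp LocFinMeasure.measurable_toMeasure
    have := h.indep m B hB hd
    rw [iIndepFun_iff_measure_inter_preimage_eq_mul] at this ⊢
    intro S sets hS
    have hmeas (i) (hi : i ∈ S) : MeasurableSet
        ((fun μ : LocFinMeasure E => (id μ).toMeasure (B i)) ⁻¹' sets i) := hm i (hS i hi)
    rw [Measure.map_apply h.measurable (S.measurableSet_biInter hmeas)]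
    rw [Finset.prod_congr rfl fun i hi => Measure.map_apply h.measurable (hmeas i hi)]
    simpa [Set.preimage_iInter, Set.preimage_preimage] using this S hS
  law B hB hlam := by
    have hm : Measurable fun μ : LocFinMeasure E => μ.toMeasure B :=
      (Measure.measurable_coe hB).comp LocFinMeasure.measurable_toMeasure
    refine ⟨hm.aemeasurable, ?_⟩
    change Measure.map (fun μ : LocFinMeasure E => μ.toMeasure B) (Measure.map N P) = _
    rw [Measure.map_map hm h.measurable]
    exact (h.law B hB hlam).map_eq

theorem measurable_empiricalProcess {E Ω : Type*} [TopologicalSpace E] [T2Space E]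
    [LocallyCompactSpace E] [SecondCountableTopology E] [MeasurableSpace E] [BorelSpace E]
    [MeasurableSpace Ω] {n : ℕ} {Y : ℕ → Ω → E} (hY : ∀ j ∈ Finset.Icc 1 n, Measurable (Y j)) :
    Measurable (empiricalProcess n Y) := by
  refine LocFinMeasure.measurable_of_toMeasure (Measure.measurable_of_measurable_coe _ fun s hs => ?_)
  simp only [empiricalProcess, Measure.finsetSum_apply, Measure.dirac_apply' _ hs]
  exact Finset.measurable_fun_sum _ fun j hj => (measurable_one.indicator hs).comp (hY j hj)

end VagueMeasurability

/-! ### Quantitative estimates for void probabilities -/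

section VoidProbabilities

theorem abs_pow_sub_pow_le_of_mem_Icc {x y : ℝ} (hx : x ∈ Set.Icc (0 : ℝ) 1)
    (hy : y ∈ Set.Icc (0 : ℝ) 1) (n : ℕ) : |x ^ n - y ^ n| ≤ n * |x - y| := by
  induction n with
  | zero => simp
  | succ n ih =>
    have h : x ^ (n + 1) - y ^ (n + 1) = x * (x ^ n - y ^ n) + (x - y) * y ^ n := by ring
    have h1 : |x * (x ^ n - y ^ n)| ≤ |x ^ n - y ^ n| := by
      rw [abs_mul, abs_of_nonneg hx.1]
      exact mul_le_of_le_one_left (abs_nonneg _) hx.2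
    have h2 : |(x - y) * y ^ n| ≤ |x - y| := by
      rw [abs_mul, abs_of_nonneg (pow_nonneg hy.1 n)]
      exact mul_le_of_le_one_right (abs_nonneg _) (pow_le_one₀ hy.1 hy.2)
    rw [h]
    push_cast
    linarith [abs_add_le (x * (x ^ n - y ^ n)) ((x - y) * y ^ n)]

/-- Serves twice: to replace a short block by an exponential, and to bound x - 1 + exp(-x), which is
the mean of (K - 1)⁺ for K Poisson with mean x. -/
theorem abs_one_sub_sub_exp_neg_le {x : ℝ} (hx : 0 ≤ x) : |1 - x - Real.exp (-x)| ≤ x ^ 2 := by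
  rcases le_total x 1 with h | h
  · have := Real.abs_exp_sub_one_sub_id_le (x := -x) (by rwa [abs_neg, abs_of_nonneg hx])
    rw [abs_sub_comm]
    convert this using 1
    · congr 1; ring
    · ring
  · have h1 : Real.exp (-x) ≤ 1 := Real.exp_le_one_iff.2 (by linarith)
    have h2 := Real.add_one_le_exp (-x)
    rw [abs_le]
    constructor <;> nlinarith

variable {Ω : Type*} [MeasurableSpace Ω]

/-- The probability that none of the events `A 1, …, A q` occurs. -/
noncomputable def voidProb (P : Measure Ω) (A : ℕ → Set Ω) (q : ℕ) : ℝ :=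
  P.real {ω | ∀ j ∈ Finset.Icc 1 q, ω ∉ A j}

variable {P : Measure Ω} [IsProbabilityMeasure P] {A : ℕ → Set Ω} {n : ℕ} {p : ℝ}

theorem voidProb_mem_Icc (q : ℕ) : voidProb P A q ∈ Set.Icc (0 : ℝ) 1 :=
  ⟨measureReal_nonneg, measureReal_le_one⟩

omit [IsProbabilityMeasure P] in
theorem measureReal_biUnion_Icc_le (hp : ∀ j ∈ Finset.Icc 1 n, P.real (A j) = p) {a b : ℕ}
    (ha : 1 ≤ a) (hb : b ≤ n) : P.real (⋃ j ∈ Finset.Icc a b, A j) ≤ (b + 1 - a : ℕ) * p := by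
  refine (measureReal_biUnion_finset_le _ _).trans ?_
  rw [Finset.sum_congr rfl fun j hj => hp j ?_]
  · simp
  · simp only [Finset.mem_Icc] at hj ⊢; omega

theorem voidProb_sub_le (hp : ∀ j ∈ Finset.Icc 1 n, P.real (A j) = p) {q q' : ℕ} (hq : q ≤ q')
    (hq' : q' ≤ n) :
    voidProb P A q' ≤ voidProb P A q ∧ voidProb P A q ≤ voidProb P A q' + (q' - q : ℕ) * p := by
  constructor
  · exact measureReal_mono fun ω hω j hj => hω j (Finset.Icc_subset_Icc_right hq hj)
  · have hsub : {ω | ∀ j ∈ Finset.Icc 1 q, ω ∉ A j} ⊆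
        {ω | ∀ j ∈ Finset.Icc 1 q', ω ∉ A j} ∪ ⋃ j ∈ Finset.Icc (q + 1) q', A j := by
      intro ω hω
      by_cases h : ∃ j ∈ Finset.Icc (q + 1) q', ω ∈ A j
      · exact Or.inr (by simpa using h)
      · refine Or.inl fun j hj => ?_
        push Not at h
        simp only [Finset.mem_Icc, Set.mem_ofPred_eq] at hj h hω
        by_cases hjq : j ≤ q
        · exact hω j ⟨hj.1, hjq⟩
        · exact h j ⟨by omega, hj.2⟩
    have h1 := (measureReal_mono (μ := P) hsub).trans (measureReal_union_le _ _)
    have h2 := measureReal_biUnion_Icc_le hp (a := q + 1) (by omega) hq'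
    rw [show q' + 1 - (q + 1) = q' - q by omega] at h2
    simp only [voidProb]
    linarith

/-- Ignoring the k events in the gap changes the probability by at most kp, by the union bound;
mixing handles the two outer blocks. -/
theorem abs_voidProb_two_mul_add_sub_sq_le (hp : ∀ j ∈ Finset.Icc 1 n, P.real (A j) = p)
    {q k : ℕ} {δ : ℝ} (hqk : 2 * q + k ≤ n)
    (hmix : |P.real {ω | (∀ j ∈ Finset.Icc 1 q, ω ∉ A j) ∧
      ∀ j ∈ Finset.Icc (q + k + 1) (2 * q + k), ω ∉ A j} - voidProb P A q ^ 2| ≤ δ) :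
    |voidProb P A (2 * q + k) - voidProb P A q ^ 2| ≤ δ + k * p := by
  set B := {ω | (∀ j ∈ Finset.Icc 1 q, ω ∉ A j) ∧
      ∀ j ∈ Finset.Icc (q + k + 1) (2 * q + k), ω ∉ A j} with hB
  have h1 : voidProb P A (2 * q + k) ≤ P.real B := by
    refine measureReal_mono fun ω hω => ⟨fun j hj => hω j ?_, fun j hj => hω j ?_⟩ <;>
    simp only [Finset.mem_Icc] at hj ⊢ <;> omega
  have h2 : P.real B ≤ voidProb P A (2 * q + k) + k * p := by
    have hsub : B ⊆ {ω | ∀ j ∈ Finset.Icc 1 (2 * q + k), ω ∉ A j} ∪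
        ⋃ j ∈ Finset.Icc (q + 1) (q + k), A j := by
      intro ω hω
      by_cases h : ∃ j ∈ Finset.Icc (q + 1) (q + k), ω ∈ A j
      · exact Or.inr (by simpa using h)
      · refine Or.inl fun j hj => ?_
        push Not at h
        simp only [hB, Finset.mem_Icc, Set.mem_ofPred_eq] at hj h hω
        by_cases hjq : j ≤ q
        · exact hω.1 j ⟨hj.1, hjq⟩
        · by_cases hjk : j ≤ q + k
          · exact h j ⟨by omega, hjk⟩
          · exact hω.2 j ⟨by omega, hj.2⟩
    have h1 := (measureReal_mono (μ := P) hsub).trans (measureReal_union_le _ _)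
    have h2 := measureReal_biUnion_Icc_le hp (a := q + 1) (b := q + k) (by omega) (by omega)
    rw [show q + k + 1 - (q + 1) = k by omega] at h2
    simp only [voidProb]
    linarith
  rw [abs_le] at hmix ⊢
  constructor <;> linarith [hmix.1, hmix.2]

/-- Induction on q: the new event removes mass p, except for its overlaps with the q earlier events,
which have mass at most qr. -/
theorem abs_voidProb_sub_one_sub_le (hA : ∀ j ∈ Finset.Icc 1 n, MeasurableSet (A j))
    (hp : ∀ j ∈ Finset.Icc 1 n, P.real (A j) = p) {r : ℝ} (hr : 0 ≤ r)
    (hpair : ∀ i j, 1 ≤ i → i < j → j ≤ n → P.real (A i ∩ A j) ≤ r) {q : ℕ} (hq : q ≤ n) :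
    |voidProb P A q - (1 - q * p)| ≤ q ^ 2 * r := by
  induction q with
  | zero => simp [voidProb]
  | succ q ih =>
    have ih := ih (by omega)
    have hq1 : q + 1 ∈ Finset.Icc 1 n := by simp; omega
    set V := {ω | ∀ j ∈ Finset.Icc 1 q, ω ∉ A j} with hV
    have hstep : voidProb P A (q + 1) = voidProb P A q - P.real (V ∩ A (q + 1)) := by
      have h := measureReal_inter_add_sdiff (μ := P) (s := V) (hA _ hq1)
      have h2 : {ω | ∀ j ∈ Finset.Icc 1 (q + 1), ω ∉ A j} = V \ A (q + 1) := by
        ext ω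
        simp only [hV, Finset.mem_Icc, Set.mem_ofPred_eq, Set.mem_sdiff]
        constructor
        · exact fun h => ⟨fun j hj => h j (by omega), h _ (by omega)⟩
        · rintro ⟨h1, h2⟩ j hj
          rcases Nat.lt_or_ge q j with h | h
          · rwa [show j = q + 1 by omega]
          · exact h1 j (by omega)
      rw [voidProb, h2, voidProb, ← h]; ring
    have hup : P.real (V ∩ A (q + 1)) ≤ p := by
      rw [← hp _ hq1]; exact measureReal_mono Set.inter_subset_right
    have hlow : p ≤ P.real (V ∩ A (q + 1)) + q * r := by
      have hsub : A (q + 1) ⊆ (V ∩ A (q + 1)) ∪ ⋃ j ∈ Finset.Icc 1 q, A j ∩ A (q + 1) := by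
        intro ω hω
        by_cases h : ω ∈ V
        · exact Or.inl ⟨h, hω⟩
        · simp only [hV, Set.mem_ofPred_eq, not_forall, not_not] at h
          obtain ⟨j, hj, hjA⟩ := h
          exact Or.inr (Set.mem_biUnion hj ⟨hjA, hω⟩)
      have h1 := (measureReal_mono (μ := P) hsub).trans (measureReal_union_le _ _)
      have h2 : P.real (⋃ j ∈ Finset.Icc 1 q, A j ∩ A (q + 1)) ≤ q * r := by
        refine (measureReal_biUnion_finset_le _ _).trans ?_
        refine (Finset.sum_le_card_nsmul _ _ r fun j hj => ?_).trans (by simp)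
        simp only [Finset.mem_Icc] at hj
        exact hpair j (q + 1) hj.1 (by omega) hq
      rw [hp _ hq1] at h1
      linarith
    have hqr : 0 ≤ (q : ℝ) * r := by positivity
    rw [hstep]
    rw [abs_le] at ih ⊢
    push_cast
    constructor <;> nlinarith [ih.1, ih.2]

/-- The three error groups come from shortening the row to 2^m s - k with s = n / 2^m, from m
successive halvings, and from replacing the void probability of a block of length s - k by an
exponential before taking the 2^m-th power. -/
theorem abs_voidProb_sub_exp_le (hA : ∀ j ∈ Finset.Icc 1 n, MeasurableSet (A j)) (hp0 : 0 ≤ p)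
    (hp : ∀ j ∈ Finset.Icc 1 n, P.real (A j) = p) {r : ℝ} (hr : 0 ≤ r)
    (hpair : ∀ i j, 1 ≤ i → i < j → j ≤ n → P.real (A i ∩ A j) ≤ r) {k : ℕ} {δ : ℝ} (hδ : 0 ≤ δ)
    (hmix : ∀ q, 2 * q + k ≤ n → |P.real {ω | (∀ j ∈ Finset.Icc 1 q, ω ∉ A j) ∧
      ∀ j ∈ Finset.Icc (q + k + 1) (2 * q + k), ω ∉ A j} - voidProb P A q ^ 2| ≤ δ)
    {m : ℕ} (hk : k ≤ n / 2 ^ m) :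
    |voidProb P A n - Real.exp (-(2 ^ m * ((n / 2 ^ m : ℕ) - k) * p))| ≤
      (2 ^ m + k) * p + 2 ^ m * (δ + k * p) +
        2 ^ m * ((n / 2 ^ m : ℕ) ^ 2 * r + ((n / 2 ^ m : ℕ) * p) ^ 2) := by
  set s := n / 2 ^ m with hs
  have hMs : 2 ^ m * s ≤ n := Nat.mul_div_le n _
  have hMs' : n < 2 ^ m * s + 2 ^ m := by
    have := Nat.lt_mul_div_succ n (show 0 < 2 ^ m by positivity)
    rw [← hs] at this; linarith [this]
  have hs0 : s - k ≤ n := by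
    have : s ≤ 2 ^ m * s := Nat.le_mul_of_pos_left _ (by positivity)
    omega
  have hδ' : 0 ≤ δ + k * p := by positivity
  -- Lengths 2^i s - k reproduce themselves exactly: two such blocks and a gap k make 2^(i+1) s - k.
  -- The error satisfies e' ≤ 2e + (δ + kp), whence the factor 2^i - 1.
  have hiter : ∀ i, i ≤ m →
      |voidProb P A (2 ^ i * s - k) - voidProb P A (s - k) ^ 2 ^ i| ≤ (2 ^ i - 1) * (δ + k * p) := by
    intro i
    induction i with
    | zero => simp
    | succ i ih =>
      intro hi
      have ih := ih (by omega)
      have h1 : s ≤ 2 ^ i * s := Nat.le_mul_of_pos_left _ (by positivity)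
      have h2 : 2 ^ (i + 1) * s ≤ 2 ^ m * s :=
        Nat.mul_le_mul_right _ (Nat.pow_le_pow_right (by norm_num) hi)
      have h3 : 2 ^ (i + 1) * s = 2 * (2 ^ i * s) := by ring
      have h4 : 2 ^ (i + 1) * s - k = 2 * (2 ^ i * s - k) + k := by omega
      have hle : 2 * (2 ^ i * s - k) + k ≤ n := by omega
      have hd := abs_voidProb_two_mul_add_sub_sq_le hp hle (hmix _ hle)
      have hsq := abs_pow_sub_pow_le_of_mem_Icc (voidProb_mem_Icc (P := P) (A := A) (2 ^ i * s - k))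
        (y := voidProb P A (s - k) ^ 2 ^ i)
        ⟨pow_nonneg (voidProb_mem_Icc _).1 _, pow_le_one₀ (voidProb_mem_Icc _).1
          (voidProb_mem_Icc _).2⟩ 2
      rw [h4, pow_succ 2 i, pow_mul]
      push_cast at hsq
      refine (abs_sub_le _ (voidProb P A (2 ^ i * s - k) ^ 2) _).trans ?_
      rw [pow_succ (2 : ℝ) i]
      nlinarith
  have h1 := hiter m le_rfl
  have h2 := voidProb_sub_le hp (q := 2 ^ m * s - k) (q' := n) (by omega) le_rfl
  have h2' : ((n - (2 ^ m * s - k) : ℕ) : ℝ) * p ≤ (2 ^ m + k) * p := by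
    refine mul_le_mul_of_nonneg_right ?_ hp0
    have : n - (2 ^ m * s - k) ≤ 2 ^ m + k := by omega
    exact_mod_cast this
  set x : ℝ := (s - k : ℕ) * p with hx
  have hx0 : 0 ≤ x := by positivity
  have hxs : x ≤ s * p := by
    refine mul_le_mul_of_nonneg_right ?_ hp0
    exact_mod_cast Nat.sub_le _ _
  have h3 : |voidProb P A (s - k) - Real.exp (-x)| ≤ s ^ 2 * r + (s * p) ^ 2 := by
    refine (abs_sub_le _ (1 - x) _).trans (add_le_add ?_ ?_)
    · refine (abs_voidProb_sub_one_sub_le hA hp hr hpair hs0).trans ?_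
      gcongr
      exact Nat.sub_le _ _
    · exact (abs_one_sub_sub_exp_neg_le hx0).trans (by gcongr)
  have h4 := abs_pow_sub_pow_le_of_mem_Icc (voidProb_mem_Icc (P := P) (A := A) (s - k))
    (y := Real.exp (-x)) ⟨(Real.exp_pos _).le, Real.exp_le_one_iff.2 (by linarith)⟩ (2 ^ m)
  have h5 : Real.exp (-(2 ^ m * ((s : ℝ) - k) * p)) = Real.exp (-x) ^ 2 ^ m := by
    rw [← Real.exp_nat_mul, hx, Nat.cast_sub hk]
    push_cast
    ring_nf
  rw [h5]
  have h6 : (2 ^ m : ℝ) * |voidProb P A (s - k) - Real.exp (-x)| ≤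
      2 ^ m * (s ^ 2 * r + (s * p) ^ 2) := by gcongr
  push_cast at h4
  rw [abs_le] at h1 h4 ⊢
  have h7 : ((2 : ℝ) ^ m - 1) * (δ + k * p) ≤ 2 ^ m * (δ + k * p) := by
    gcongr; linarith
  constructor <;> linarith [h1.1, h1.2, h4.1, h4.2, h2.1, h2.2]

end VoidProbabilities

/-! ### Choice of scales and the limit of void probabilities -/

section VoidProbabilityLimit

/-- With v = n^α and b = -log θ the sequence is at most v^(1/α) exp(-bv), and the exponential beats
the power. -/
theorem tendsto_nat_mul_pow_ceil_rpow {θ α : ℝ} (h0 : 0 < θ) (h1 : θ < 1) (hα : 0 < α) :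
    Tendsto (fun n : ℕ => (n : ℝ) * θ ^ ⌈(n : ℝ) ^ α⌉₊) atTop (𝓝 0) := by
  have hb : 0 < -Real.log θ := by have := Real.log_neg h0 h1; linarith
  have hu : Tendsto (fun n : ℕ => (n : ℝ) ^ α) atTop atTop :=
    (tendsto_rpow_atTop hα).comp tendsto_natCast_atTop_atTop
  have h := (tendsto_rpow_mul_exp_neg_mul_atTop_nhds_zero (1 / α) _ hb).comp hu
  refine squeeze_zero (fun n => by positivity) (fun n => ?_) h
  simp only [Function.comp_apply]
  rw [← Real.rpow_mul (by positivity), mul_one_div_cancel hα.ne', Real.rpow_one]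
  gcongr
  rw [neg_neg, ← Real.rpow_def_of_pos h0, ← Real.rpow_natCast]
  exact Real.rpow_le_rpow_of_exponent_ge h0 h1.le (Nat.le_ceil _)

/-- Poisson limit for void probabilities of rare events with short-range pair bounds and
exponentially mixing blocks. -/
theorem tendsto_voidProb {Ω : ℕ → Type*} [∀ n, MeasurableSpace (Ω n)]
    {P : ∀ n, Measure (Ω n)} [∀ n, IsProbabilityMeasure (P n)] {A : ∀ n, ℕ → Set (Ω n)}
    (hA : ∀ n, ∀ j ∈ Finset.Icc 1 n, MeasurableSet (A n j)) {p : ℕ → ℝ}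
    (hp : ∀ n, ∀ j ∈ Finset.Icc 1 n, (P n).real (A n j) = p n) {ℓ : ℝ}
    (hlim : Tendsto (fun n : ℕ => n * p n) atTop (𝓝 ℓ))
    {ε : ℝ} (hε : 0 < ε) {r : ℕ → ℝ} (hr : r =o[atTop] (fun n : ℕ => 1 / (n : ℝ) ^ (1 + ε)))
    (hpair : ∀ n i j : ℕ, 1 ≤ i → i < j → j ≤ n → (P n).real (A n i ∩ A n j) ≤ r n)
    {θ C : ℝ} (hθ0 : 0 < θ) (hθ1 : θ < 1) (hC : 0 < C)
    (hmix : ∀ k n q : ℕ, 2 * q + k ≤ n →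
      |(P n).real {ω | (∀ j ∈ Finset.Icc 1 q, ω ∉ A n j) ∧
        ∀ j ∈ Finset.Icc (q + k + 1) (2 * q + k), ω ∉ A n j} - voidProb (P n) (A n) q ^ 2|
        ≤ C * θ ^ k) :
    Tendsto (fun n => voidProb (P n) (A n) n) atTop (𝓝 (Real.exp (-ℓ))) := by
  -- The bound α ≤ ε makes n u⁴ r tend to 0 for u = n^(α/4), and α ≤ 1 gives u⁴ ≤ n.
  set α := min ε 1 with hα
  have hα0 : 0 < α := lt_min hε one_pos
  set u : ℕ → ℝ := fun n => (n : ℝ) ^ (α / 4) with hu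
  have hutop : Tendsto u atTop atTop :=
    (tendsto_rpow_atTop (by positivity)).comp tendsto_natCast_atTop_atTop
  -- The scales are: gap k of order u, 2^m of order n/u², blocks s of order u². Then the discarded
  -- fraction k/s is of order 1/u, while 2^m θ^k ≤ nθ^k and 2^m s² |r|, of order n u² |r|, both
  -- vanish.
  set k : ℕ → ℕ := fun n => ⌈u n⌉₊ with hk
  set m : ℕ → ℕ := fun n => Nat.log 2 ⌊(n : ℝ) / u n ^ 2⌋₊ with hm
  set s : ℕ → ℕ := fun n => n / 2 ^ m n with hs
  have hu4 (n : ℕ) : u n ^ 4 = (n : ℝ) ^ α := by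
    simp only [hu]
    rw [← Real.rpow_natCast, ← Real.rpow_mul (by positivity)]
    congr 1; push_cast; ring
  have hu4n (n : ℕ) (hn : 1 ≤ n) : u n ^ 4 ≤ n := by
    rw [hu4]
    calc (n : ℝ) ^ α ≤ (n : ℝ) ^ (1 : ℝ) :=
          Real.rpow_le_rpow_of_exponent_le (by exact_mod_cast hn) (min_le_right _ _)
      _ = n := Real.rpow_one _
  have hru : Tendsto (fun n => n * u n ^ 4 * |r n|) atTop (𝓝 0) := by
    have h1 : Tendsto (fun n : ℕ => |r n| * (n : ℝ) ^ (1 + ε)) atTop (𝓝 0) := by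
      have := hr.tendsto_div_nhds_zero.abs
      simp only [abs_zero] at this
      refine this.congr fun n => ?_
      rw [div_div_eq_mul_div, div_one, abs_mul, abs_of_nonneg (a := (n : ℝ) ^ (1 + ε)) (by positivity)]
    refine squeeze_zero' (Eventually.of_forall fun n => by positivity) ?_ h1
    filter_upwards [eventually_ge_atTop 1] with n hn
    have hn' : (1 : ℝ) ≤ n := by exact_mod_cast hn
    rw [mul_comm]
    gcongr
    rw [hu4, Real.rpow_add (by positivity), Real.rpow_one]
    gcongr
    exact min_le_left _ _
  have hmain : ∀ᶠ n : ℕ in atTop, 1 ≤ n ∧ 1 ≤ u n ∧ (2 : ℝ) ^ m n ≤ n / u n ^ 2 ∧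
      (s n : ℝ) ≤ 2 * u n ^ 2 ∧ (k n : ℝ) ≤ 2 * u n ∧ k n ≤ s n ∧ (2 : ℝ) ^ m n * s n ≤ n ∧
      (n : ℝ) ≤ 2 ^ m n * s n + 2 ^ m n := by
    -- The bound u ≥ 3 gives k ≤ u + 1 ≤ u² - 1 ≤ s, so a gap fits inside a block.
    filter_upwards [eventually_ge_atTop 1, hutop.eventually_ge_atTop 3] with n hn hun
    have hn' : (1 : ℝ) ≤ n := by exact_mod_cast hn
    have hu1 : 1 ≤ u n := by linarith
    have hu0 : 0 < u n ^ 2 := by positivity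
    have h4 := hu4n n hn
    have hy : 1 ≤ (n : ℝ) / u n ^ 2 := by
      rw [le_div_iff₀ hu0]
      nlinarith
    have hfl : ⌊(n : ℝ) / u n ^ 2⌋₊ ≠ 0 := (Nat.floor_pos.2 hy).ne'
    have hM1 : (2 : ℝ) ^ m n ≤ n / u n ^ 2 := by
      have := Nat.pow_log_le_self 2 hfl
      calc (2 : ℝ) ^ m n = ((2 ^ m n : ℕ) : ℝ) := by push_cast; rfl
        _ ≤ (⌊(n : ℝ) / u n ^ 2⌋₊ : ℝ) := by exact_mod_cast this
        _ ≤ _ := Nat.floor_le (by positivity)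
    have hM2 : (n : ℝ) / u n ^ 2 ≤ 2 * 2 ^ m n := by
      have h := Nat.lt_pow_succ_log_self (b := 2) (by norm_num) ⌊(n : ℝ) / u n ^ 2⌋₊
      have h' : ⌊(n : ℝ) / u n ^ 2⌋₊ + 1 ≤ 2 * 2 ^ m n := by
        have e : 2 ^ (m n).succ = 2 * 2 ^ m n := by rw [Nat.succ_eq_add_one, pow_succ, mul_comm]
        rw [← e]; exact h
      calc (n : ℝ) / u n ^ 2 ≤ (⌊(n : ℝ) / u n ^ 2⌋₊ : ℝ) + 1 := (Nat.lt_floor_add_one _).le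
        _ ≤ _ := by exact_mod_cast h'
    have hMpos : (0 : ℝ) < 2 ^ m n := by positivity
    have hMs : (2 : ℝ) ^ m n * s n ≤ n := by exact_mod_cast Nat.mul_div_le n (2 ^ m n)
    have hMs' : (n : ℝ) ≤ 2 ^ m n * s n + 2 ^ m n := by
      have := Nat.lt_mul_div_succ n (show 0 < 2 ^ m n by positivity)
      have h : n ≤ 2 ^ m n * s n + 2 ^ m n := by simp only [hs]; linarith [this]
      exact_mod_cast h
    have hk2 : (k n : ℝ) ≤ u n + 1 := (Nat.ceil_lt_add_one (by positivity)).le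
    rw [le_div_iff₀ hu0] at hM1
    rw [div_le_iff₀ hu0] at hM2
    have hs2 : (s n : ℝ) ≤ 2 * u n ^ 2 := by
      refine le_of_mul_le_mul_left ?_ hMpos
      linarith
    have hs1 : u n ^ 2 ≤ s n + 1 := by
      refine le_of_mul_le_mul_left ?_ hMpos
      linarith
    refine ⟨hn, hu1, (le_div_iff₀ hu0).2 hM1, hs2, by linarith, ?_, hMs, hMs'⟩
    have : (k n : ℝ) ≤ s n := by nlinarith
    exact_mod_cast this
  have hp0 (n : ℕ) (hn : 1 ≤ n) : 0 ≤ p n := by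
    rw [← hp n 1 (by simpa using hn)]; exact measureReal_nonneg
  have hinv : Tendsto (fun n => (u n)⁻¹) atTop (𝓝 0) := tendsto_inv_atTop_zero.comp hutop
  have hnp : ∀ᶠ n : ℕ in atTop, n * p n ≤ ℓ + 1 :=
    hlim.eventually (eventually_le_nhds (lt_add_one ℓ))
  set c := ℓ + 1
  -- the exponent converges
  have hexp : Tendsto (fun n => (2 : ℝ) ^ m n * ((s n : ℝ) - k n) * p n) atTop (𝓝 ℓ) := by
    have hlow : Tendsto (fun n : ℕ => n * p n - 3 * c * (u n)⁻¹) atTop (𝓝 ℓ) := by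
      simpa using hlim.sub (hinv.const_mul (3 * c))
    refine tendsto_of_tendsto_of_tendsto_of_le_of_le' hlow hlim ?_ ?_
    · filter_upwards [hmain, hnp] with n ⟨hn, hu1, hM, hs2, hk2, hks, hMs, hMs'⟩ hc
      have hp := hp0 n hn
      have hMp : 2 ^ m n * p n ≤ c * (u n)⁻¹ ^ 2 := by
        calc 2 ^ m n * p n ≤ n / u n ^ 2 * p n := by gcongr
          _ = n * p n * (u n)⁻¹ ^ 2 := by rw [inv_pow]; ring
          _ ≤ _ := by gcongr
      have hkM : 2 ^ m n * p n * k n ≤ c * (u n)⁻¹ ^ 2 * (2 * u n) := by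
        have := mul_nonneg (pow_nonneg (zero_le_two (α := ℝ)) (m n)) hp
        gcongr
        exact this.trans hMp
      have e : c * (u n)⁻¹ ^ 2 * (2 * u n) = 2 * c * (u n)⁻¹ := by field_simp
      have hc0 : 0 ≤ c := (mul_nonneg (Nat.cast_nonneg n) hp).trans hc
      have hle : c * (u n)⁻¹ ^ 2 ≤ c * (u n)⁻¹ := by
        have : (u n)⁻¹ ≤ 1 := inv_le_one_of_one_le₀ hu1
        have h0 : 0 ≤ (u n)⁻¹ := by positivity
        gcongr
        nlinarith
      have hns : (n : ℝ) * p n ≤ (2 ^ m n * s n + 2 ^ m n) * p n := by gcongr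
      nlinarith
    · filter_upwards [hmain] with n ⟨hn, hu1, hM, hs2, hk2, hks, hMs, hMs'⟩
      have hp := hp0 n hn
      have h1 : (2 : ℝ) ^ m n * ((s n : ℝ) - k n) ≤ 2 ^ m n * s n := by
        gcongr; linarith [(Nat.cast_nonneg (k n) : (0 : ℝ) ≤ k n)]
      exact mul_le_mul_of_nonneg_right (h1.trans hMs) hp
  have hexp' := (Real.continuous_exp.tendsto _).comp hexp.neg
  -- the error tends to zero
  set b : ℕ → ℝ := fun n => c * (u n)⁻¹ ^ 2 + 2 * c * (u n)⁻¹ ^ 3 + C * (n * θ ^ k n) +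
    2 * c * (u n)⁻¹ + 2 * (n * u n ^ 4 * |r n|) * (u n)⁻¹ ^ 2 + 2 * c ^ 2 * (u n)⁻¹ ^ 2 with hb
  have hb0 : Tendsto b atTop (𝓝 0) := by
    have h2 := tendsto_nat_mul_pow_ceil_rpow hθ0 hθ1 (show 0 < α / 4 by positivity)
    have := ((((((hinv.pow 2).const_mul c).add ((hinv.pow 3).const_mul (2 * c))).add
      (h2.const_mul C)).add (hinv.const_mul (2 * c))).add
      ((hru.const_mul 2).mul (hinv.pow 2))).add ((hinv.pow 2).const_mul (2 * c ^ 2))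
    simp only [ne_eq, OfNat.ofNat_ne_zero, not_false_eq_true, zero_pow, mul_zero, add_zero] at this
    exact this
  have hdiff : Tendsto (fun n => voidProb (P n) (A n) n -
      Real.exp (-(2 ^ m n * ((s n : ℝ) - k n) * p n))) atTop (𝓝 0) := by
    refine squeeze_zero_norm' ?_ hb0
    filter_upwards [hmain, hnp] with n ⟨hn, hu1, hM, hs2, hk2, hks, hMs, hMs'⟩ hc
    have hp' := hp0 n hn
    have hn0 : (0 : ℝ) < n := by exact_mod_cast hn
    have hc0 : 0 ≤ c := (mul_nonneg (Nat.cast_nonneg n) hp').trans hc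
    have hu0 : 0 < u n := by linarith
    refine (abs_voidProb_sub_exp_le (hA n) hp' (hp n) (abs_nonneg (r n))
      (fun i j hi hij hj => (hpair n i j hi hij hj).trans (le_abs_self _)) (k := k n)
      (δ := C * θ ^ k n) (by positivity) (fun q hq => hmix (k n) n q hq) (m := m n) hks).trans ?_
    change (2 ^ m n + (k n : ℝ)) * p n + 2 ^ m n * (C * θ ^ k n + k n * p n) +
        2 ^ m n * ((s n : ℝ) ^ 2 * |r n| + (s n * p n) ^ 2) ≤ b n
    have hMp : 2 ^ m n * p n ≤ c * (u n)⁻¹ ^ 2 := by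
      calc 2 ^ m n * p n ≤ n / u n ^ 2 * p n := by gcongr
        _ = n * p n * (u n)⁻¹ ^ 2 := by rw [inv_pow]; ring
        _ ≤ _ := by gcongr
    have hMp0 : 0 ≤ 2 ^ m n * p n := by positivity
    have hninv : (n : ℝ)⁻¹ ≤ (u n)⁻¹ ^ 4 := by
      rw [inv_pow]; exact inv_anti₀ (by positivity) (hu4n n hn)
    have hpn : p n ≤ c * (u n)⁻¹ ^ 4 := by
      calc p n = n * p n * (n : ℝ)⁻¹ := by field_simp
        _ ≤ _ := by gcongr
    have t1 : (2 ^ m n + (k n : ℝ)) * p n ≤ c * (u n)⁻¹ ^ 2 + 2 * c * (u n)⁻¹ ^ 3 := by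
      rw [add_mul]
      refine add_le_add hMp ?_
      calc k n * p n ≤ 2 * u n * (c * (u n)⁻¹ ^ 4) := by gcongr
        _ = _ := by field_simp
    have hMn : (2 : ℝ) ^ m n ≤ n := hM.trans (div_le_self hn0.le (one_le_pow₀ hu1))
    have t2 : 2 ^ m n * (C * θ ^ k n + k n * p n) ≤ C * (n * θ ^ k n) + 2 * c * (u n)⁻¹ := by
      rw [mul_add]
      refine add_le_add ?_ ?_
      · calc (2 : ℝ) ^ m n * (C * θ ^ k n) ≤ n * (C * θ ^ k n) := by gcongr
          _ = _ := by ring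
      · calc 2 ^ m n * (k n * p n) = (2 ^ m n * p n) * k n := by ring
          _ ≤ c * (u n)⁻¹ ^ 2 * (2 * u n) := by gcongr
          _ = _ := by field_simp
    have t3 : 2 ^ m n * ((s n : ℝ) ^ 2 * |r n| + (s n * p n) ^ 2) ≤
        2 * (n * u n ^ 4 * |r n|) * (u n)⁻¹ ^ 2 + 2 * c ^ 2 * (u n)⁻¹ ^ 2 := by
      rw [mul_add]
      refine add_le_add ?_ ?_
      · calc 2 ^ m n * ((s n : ℝ) ^ 2 * |r n|) = (2 ^ m n * s n) * s n * |r n| := by ring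
          _ ≤ n * (2 * u n ^ 2) * |r n| := by gcongr
          _ = _ := by field_simp
      · calc 2 ^ m n * (s n * p n) ^ 2 = (2 ^ m n * s n) * p n * (s n * p n) := by ring
          _ ≤ n * p n * (2 * u n ^ 2 * (c * (u n)⁻¹ ^ 4)) := by gcongr
          _ ≤ c * (2 * u n ^ 2 * (c * (u n)⁻¹ ^ 4)) := by gcongr
          _ = _ := by field_simp
    simp only [hb]
    linarith
  simpa using hdiff.add hexp'

end VoidProbabilityLimit

/-! ### Replacing test integrals by functions of the occupied cells -/

section Discretization

open scoped Classical in
-- Off the null set Z the integral splits over the cells; an empty cell contributes nothing, and one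
-- of mass 1 contributes `y l` up to w.
theorem abs_integral_sub_sum_le {E ι : Type*} [MeasurableSpace E] [Fintype ι] {μ : Measure E}
    {J : ι → Set E} {Z : Set E} (hJ : ∀ l, MeasurableSet (J l))
    (hd : Pairwise (Function.onFun Disjoint J)) (h01 : ∀ l, μ (J l) = 0 ∨ μ (J l) = 1)
    (hZ : μ Z = 0) {f : E → ℝ} (hf : Integrable f μ) (hf0 : ∀ x, (∀ l, x ∉ J l) → x ∉ Z → f x = 0)
    {y : ι → ℝ} {w : ℝ} (hy : ∀ l, ∀ x ∈ J l, |f x - y l| ≤ w) :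
    |∫ x, f x ∂μ - ∑ l, if μ (J l) = 0 then 0 else y l| ≤ w * ∑ l, μ.real (J l) := by
  have h1 : ∫ x, f x ∂μ = ∑ l, ∫ x in J l, f x ∂μ := by
    rw [← integral_iUnion_fintype hJ hd fun l => hf.integrableOn]
    refine (setIntegral_eq_integral_of_ae_compl_eq_zero ?_).symm
    filter_upwards [measure_eq_zero_iff_ae_notMem.1 hZ] with x hx hxJ
    exact hf0 x (fun l hl => hxJ (Set.mem_iUnion.2 ⟨l, hl⟩)) hx
  rw [h1, ← Finset.sum_sub_distrib, Finset.mul_sum]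
  refine (Finset.abs_sum_le_sum_abs _ _).trans (Finset.sum_le_sum fun l _ => ?_)
  have hfin : μ (J l) < ∞ := by rcases h01 l with h | h <;> simp [h]
  have h2 : (if μ (J l) = 0 then 0 else y l) = ∫ _ in J l, y l ∂μ := by
    rw [setIntegral_const, smul_eq_mul, measureReal_def]
    rcases h01 l with h | h <;> simp [h]
  rw [h2, ← integral_sub hf.integrableOn (integrableOn_const hfin.ne)]
  rw [← Real.norm_eq_abs]
  exact norm_setIntegral_le_of_norm_le_const hfin (fun x hx => hy l x hx)

variable {Ω : Type*} [MeasurableSpace Ω] {P : Measure Ω} [IsProbabilityMeasure P]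

open scoped Classical in
-- For an integer count, ξ(J) - 1 + 1{ξ(J) = 0} is (ξ(J) - 1)⁺, which is at least 1 once J has two
-- points. Hence the B-term pays for multiple points and for hits of Z, where only the oscillation
-- of L is available; elsewhere the Lipschitz bound applies.
theorem abs_integral_sub_integral_discretization_le {E ι κ : Type*} [TopologicalSpace E]
    [T2Space E] [LocallyCompactSpace E] [SecondCountableTopology E] [MeasurableSpace E]
    [BorelSpace E] [Fintype ι] [Fintype κ] {ξ : Ω → Measure E}
    (hξ : Measurable ξ) [∀ ω, IsLocallyFiniteMeasure (ξ ω)] {J : ι → Set E} {Z : Set E}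
    (hJ : ∀ l, MeasurableSet (J l)) (hZ : MeasurableSet Z)
    (hd : Pairwise (Function.onFun Disjoint J)) (hJc : ∀ l, ∀ᵐ ω ∂P, ∃ k : ℕ, ξ ω (J l) = k)
    (hZc : ∀ᵐ ω ∂P, ∃ k : ℕ, ξ ω Z = k) (hJi : ∀ l, ∫⁻ ω, ξ ω (J l) ∂P ≠ ∞)
    (hZi : ∫⁻ ω, ξ ω Z ∂P ≠ ∞) {f : κ → C_c(E, ℝ)}
    (hf0 : ∀ i x, (∀ l, x ∉ J l) → x ∉ Z → f i x = 0) {y : κ → ι → ℝ} {w : ℝ} (hw : 0 ≤ w)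
    (hy : ∀ i l, ∀ x ∈ J l, |f i x - y i l| ≤ w) {L : (κ → ℝ) → ℝ} {B : ℝ}
    (hB : ∀ x y, dist (L x) (L y) ≤ B) {K : ℝ≥0} (hL : LipschitzWith K L) :
    |∫ ω, L (fun i => ∫ x, f i x ∂ξ ω) ∂P -
        ∫ ω, L (fun i => ∑ l, if ξ ω (J l) = 0 then 0 else y i l) ∂P| ≤
      B * (∑ l, ((∫⁻ ω, ξ ω (J l) ∂P).toReal - 1 + P.real {ω | ξ ω (J l) = 0}) +
        (∫⁻ ω, ξ ω Z ∂P).toReal) + K * w * ∑ l, (∫⁻ ω, ξ ω (J l) ∂P).toReal := by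
  have hm {s : Set E} (hs : MeasurableSet s) : Measurable fun ω => ξ ω s :=
    (Measure.measurable_coe hs).comp hξ
  have hB0 : 0 ≤ B := dist_nonneg.trans (hB 0 0)
  have hbdd (g : Ω → κ → ℝ) (hg : Measurable g) : Integrable (fun ω => L (g ω)) P := by
    refine Integrable.of_bound (hL.continuous.measurable.comp hg).aestronglyMeasurable
      (‖L 0‖ + B) (ae_of_all _ fun ω => ?_)
    have := norm_sub_norm_le (L (g ω)) (L 0)
    have h2 := hB (g ω) 0
    rw [dist_eq_norm] at h2
    linarith
  have hg1 : Measurable fun ω (i : κ) => ∫ x, f i x ∂ξ ω :=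
    measurable_pi_lambda _ fun i => LocFinMeasure.measurable_integral_of_measurable hξ (f i)
  have hg2 : Measurable fun ω (i : κ) => ∑ l, if ξ ω (J l) = 0 then 0 else y i l :=
    measurable_pi_lambda _ fun i => Finset.measurable_fun_sum _ fun l _ =>
      Measurable.ite (hm (hJ l) (measurableSet_singleton 0)) measurable_const measurable_const
  rw [← integral_sub (hbdd _ hg1) (hbdd _ hg2)]
  have hJint (l) : Integrable (fun ω => (ξ ω).real (J l)) P :=
    integrable_toReal_of_lintegral_ne_top (hm (hJ l)).aemeasurable (hJi l)
  have hZint : Integrable (fun ω => (ξ ω).real Z) P :=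
    integrable_toReal_of_lintegral_ne_top (hm hZ).aemeasurable hZi
  have h0m (l) : MeasurableSet {ω | ξ ω (J l) = 0} := hm (hJ l) (measurableSet_singleton 0)
  have h0int (l) : Integrable ({ω | ξ ω (J l) = 0}.indicator (fun _ => (1 : ℝ))) P :=
    (integrable_const 1).indicator (h0m l)
  -- R is an almost sure majorant of the difference, whose expectation is the claimed bound.
  set R : Ω → ℝ := fun ω => B * (∑ l, ((ξ ω).real (J l) - 1 +
    {ω | ξ ω (J l) = 0}.indicator (fun _ => (1 : ℝ)) ω) + (ξ ω).real Z) +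
    K * w * ∑ l, (ξ ω).real (J l) with hR
  have hterm (l) : Integrable (fun ω => (ξ ω).real (J l) - 1 +
      {ω | ξ ω (J l) = 0}.indicator (fun _ => (1 : ℝ)) ω) P :=
    ((hJint l).sub (integrable_const 1)).add (h0int l)
  have hS1 := integrable_finsetSum Finset.univ fun l _ => hterm l
  have hS2 := integrable_finsetSum Finset.univ fun l _ => hJint l
  have hS1Z : Integrable (fun ω => ∑ l, ((ξ ω).real (J l) - 1 +
      {ω | ξ ω (J l) = 0}.indicator (fun _ => (1 : ℝ)) ω) + (ξ ω).real Z) P := hS1.add hZint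
  have hRint : Integrable R P :=
    (hS1Z.const_mul B).add (hS2.const_mul (K * w))
  have hRval : ∫ ω, R ω ∂P = B * (∑ l, ((∫⁻ ω, ξ ω (J l) ∂P).toReal - 1 +
      P.real {ω | ξ ω (J l) = 0}) + (∫⁻ ω, ξ ω Z ∂P).toReal) +
      K * w * ∑ l, (∫⁻ ω, ξ ω (J l) ∂P).toReal := by
    have e1 {s : Set E} (hs : MeasurableSet s) (h : ∫⁻ ω, ξ ω s ∂P ≠ ∞) :
        ∫ ω, (ξ ω).real s ∂P = (∫⁻ ω, ξ ω s ∂P).toReal :=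
      integral_toReal (hm hs).aemeasurable (ae_lt_top (hm hs) h)
    simp only [hR]
    rw [integral_add (hS1Z.const_mul B) (hS2.const_mul (K * w)),
      integral_const_mul, integral_const_mul, integral_add hS1 hZint,
      integral_finsetSum _ fun l _ => hterm l, integral_finsetSum _ fun l _ => hJint l, e1 hZ hZi]
    rw [Finset.sum_congr rfl fun l _ => e1 (hJ l) (hJi l)]
    congr 3
    refine Finset.sum_congr rfl fun l _ => ?_
    have hl : Integrable (fun ω => (ξ ω).real (J l) - 1) P := (hJint l).sub (integrable_const 1)
    rw [integral_add hl (h0int l),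
      integral_sub (hJint l) (integrable_const 1), e1 (hJ l) (hJi l),
      integral_indicator_const _ (h0m l)]
    simp
  rw [← hRval, ← Real.norm_eq_abs]
  refine norm_integral_le_of_norm_le hRint ?_
  have hJfin : ∀ᵐ ω ∂P, ∀ l, ξ ω (J l) < ∞ := ae_all_iff.2 fun l => ae_lt_top (hm (hJ l)) (hJi l)
  filter_upwards [ae_all_iff.2 hJc, hZc, hJfin, ae_lt_top (hm hZ) hZi] with ω h1 h2 h3 h4
  have hnn : ∀ l, 0 ≤ (ξ ω).real (J l) - 1 +
      {ω | ξ ω (J l) = 0}.indicator (fun _ => (1 : ℝ)) ω := by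
    intro l
    obtain ⟨k, hk⟩ := h1 l
    rcases Nat.eq_zero_or_pos k with rfl | hk0
    · simp [Set.indicator, measureReal_def, hk]
    · have : (1 : ℝ) ≤ k := by exact_mod_cast hk0
      have h0 : k ≠ 0 := by omega
      simp [Set.indicator, measureReal_def, hk, h0, this]
  have hKw : 0 ≤ K * w * ∑ l, (ξ ω).real (J l) := by positivity
  by_cases hgood : (∀ l, ξ ω (J l) = 0 ∨ ξ ω (J l) = 1) ∧ ξ ω Z = 0
  · have hb : 0 ≤ B * (∑ l, ((ξ ω).real (J l) - 1 +
        {ω | ξ ω (J l) = 0}.indicator (fun _ => (1 : ℝ)) ω) + (ξ ω).real Z) :=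
      mul_nonneg hB0 (add_nonneg (Finset.sum_nonneg fun l _ => hnn l) measureReal_nonneg)
    have hdist := hL.dist_le_mul (fun i => ∫ x, f i x ∂ξ ω)
      (fun i => ∑ l, if ξ ω (J l) = 0 then 0 else y i l)
    rw [dist_eq_norm] at hdist
    have hpi : dist (fun i => ∫ x, f i x ∂ξ ω)
        (fun i => ∑ l, if ξ ω (J l) = 0 then 0 else y i l) ≤ w * ∑ l, (ξ ω).real (J l) := by
      refine (dist_pi_le_iff (by positivity)).2 fun i => ?_
      exact abs_integral_sub_sum_le hJ hd hgood.1 hgood.2 (f i).integrable (hf0 i) (hy i)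
    have := mul_le_mul_of_nonneg_left hpi K.coe_nonneg
    simp only [hR]
    linarith
  · have hone : 1 ≤ ∑ l, ((ξ ω).real (J l) - 1 +
        {ω | ξ ω (J l) = 0}.indicator (fun _ => (1 : ℝ)) ω) + (ξ ω).real Z := by
      rw [not_and_or] at hgood
      rcases hgood with hg | hg
      · push Not at hg
        obtain ⟨l, hl0, hl1⟩ := hg
        obtain ⟨k, hk⟩ := h1 l
        have hk2 : 2 ≤ k := by
          rcases k with _ | _ | k
          · simp [hk] at hl0
          · simp [hk] at hl1
          · omega
        have hk2' : (2 : ℝ) ≤ k := by exact_mod_cast hk2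
        have hle := Finset.single_le_sum (f := fun l => (ξ ω).real (J l) - 1 +
          {ω | ξ ω (J l) = 0}.indicator (fun _ => (1 : ℝ)) ω) (fun l _ => hnn l) (Finset.mem_univ l)
        have hval : 1 ≤ (ξ ω).real (J l) - 1 +
            {ω | ξ ω (J l) = 0}.indicator (fun _ => (1 : ℝ)) ω := by
          have h0 : k ≠ 0 := by omega
          simp [Set.indicator, measureReal_def, hk, h0]
          linarith
        have hZnn : 0 ≤ (ξ ω).real Z := measureReal_nonneg
        linarith
      · obtain ⟨k, hk⟩ := h2
        have hk0 : k ≠ 0 := by rintro rfl; exact hg (by simpa using hk)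
        have : (1 : ℝ) ≤ k := by exact_mod_cast Nat.pos_of_ne_zero hk0
        have hZ1 : 1 ≤ (ξ ω).real Z := by simpa [measureReal_def, hk] using this
        have := Finset.sum_nonneg fun l (_ : l ∈ Finset.univ) => hnn l
        linarith
    have hbd := hB (fun i => ∫ x, f i x ∂ξ ω) (fun i => ∑ l, if ξ ω (J l) = 0 then 0 else y i l)
    rw [dist_eq_norm] at hbd
    have := mul_le_mul_of_nonneg_left hone hB0
    simp only [hR]
    linarith

end Discretization

/-! ### Joint laws of finitely many events by inclusion-exclusion -/

section JointIndicators

theorem measureReal_inter_compl_insert {ι Ω : Type*} [DecidableEq ι] [MeasurableSpace Ω]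
    (P : Measure Ω) [IsProbabilityMeasure P] {D : ι → Set Ω} (hD : ∀ l, MeasurableSet (D l))
    {T S : Finset ι} {a : ι} :
    P.real ((⋂ l ∈ T, D l) ∩ ⋂ l ∈ insert a S, (D l)ᶜ) =
      P.real ((⋂ l ∈ T, D l) ∩ ⋂ l ∈ S, (D l)ᶜ) -
      P.real ((⋂ l ∈ insert a T, D l) ∩ ⋂ l ∈ S, (D l)ᶜ) := by
  rw [← measureReal_inter_add_sdiff (μ := P)
    (s := (⋂ l ∈ T, D l) ∩ ⋂ l ∈ S, (D l)ᶜ) (hD a)]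
  have e1 : (⋂ l ∈ T, D l) ∩ (⋂ l ∈ insert a S, (D l)ᶜ) =
      ((⋂ l ∈ T, D l) ∩ ⋂ l ∈ S, (D l)ᶜ) \ D a := by
    rw [Finset.set_biInter_insert, Set.sdiff_eq]; ac_rfl
  have e2 : (⋂ l ∈ insert a T, D l) ∩ (⋂ l ∈ S, (D l)ᶜ) =
      ((⋂ l ∈ T, D l) ∩ ⋂ l ∈ S, (D l)ᶜ) ∩ D a := by
    rw [Finset.set_biInter_insert]; ac_rfl
  rw [e1, e2]; ring

/-- Convergence of the probabilities of finite intersections of events entails convergence of the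
joint law of the events. -/
theorem tendsto_measureReal_inter_compl {ι Ω' : Type*} {Ω : ℕ → Type*}
    [∀ n, MeasurableSpace (Ω n)] {P : ∀ n, Measure (Ω n)} [∀ n, IsProbabilityMeasure (P n)]
    [MeasurableSpace Ω'] {P' : Measure Ω'} [IsProbabilityMeasure P'] {D : ∀ n, ι → Set (Ω n)}
    {D' : ι → Set Ω'} (hD : ∀ n l, MeasurableSet (D n l)) (hD' : ∀ l, MeasurableSet (D' l))
    (h : ∀ T : Finset ι, Tendsto (fun n => (P n).real (⋂ l ∈ T, D n l)) atTop
      (𝓝 (P'.real (⋂ l ∈ T, D' l)))) (T S : Finset ι) :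
    Tendsto (fun n => (P n).real ((⋂ l ∈ T, D n l) ∩ ⋂ l ∈ S, (D n l)ᶜ)) atTop
      (𝓝 (P'.real ((⋂ l ∈ T, D' l) ∩ ⋂ l ∈ S, (D' l)ᶜ))) := by
  classical
  induction S using Finset.induction_on generalizing T with
  | empty => simpa using h T
  | insert a S ha ih =>
    rw [measureReal_inter_compl_insert P' hD']
    exact ((ih T).sub (ih (insert a T))).congr fun n =>
      (measureReal_inter_compl_insert (P n) (hD n)).symm

open scoped Classical in
-- Each ω lies in exactly one atom of the finite algebra generated by the events, the one indexed by
-- the events that contain ω.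
theorem integral_indicators_eq_sum {ι Ω : Type*} [Fintype ι] [MeasurableSpace Ω] {P : Measure Ω}
    [IsProbabilityMeasure P] {D : ι → Set Ω} (hD : ∀ l, MeasurableSet (D l))
    (g : Finset ι → ℝ) :
    ∫ ω, g (Finset.univ.filter fun l => ω ∈ D l) ∂P =
      ∑ T : Finset ι, P.real ((⋂ l ∈ T, D l) ∩ ⋂ l ∈ Tᶜ, (D l)ᶜ) * g T := by
  have hm (T : Finset ι) : MeasurableSet ((⋂ l ∈ T, D l) ∩ ⋂ l ∈ Tᶜ, (D l)ᶜ) :=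
    (T.measurableSet_biInter fun l _ => hD l).inter
      (Tᶜ.measurableSet_biInter fun l _ => (hD l).compl)
  have hmem (T : Finset ι) (ω : Ω) : ω ∈ (⋂ l ∈ T, D l) ∩ (⋂ l ∈ Tᶜ, (D l)ᶜ) ↔
      T = Finset.univ.filter fun l => ω ∈ D l := by
    simp only [Set.mem_inter_iff, Set.mem_iInter, Finset.mem_compl, Set.mem_compl_iff,
      Finset.ext_iff, Finset.mem_filter, Finset.mem_univ, true_and]
    exact ⟨fun h l => ⟨h.1 l, fun hl => by_contra fun hT => h.2 l hT hl⟩,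
      fun h => ⟨fun l => (h l).1, fun l hl hD => hl ((h l).2 hD)⟩⟩
  have hsum (ω : Ω) : g (Finset.univ.filter fun l => ω ∈ D l) = ∑ T : Finset ι,
      ((⋂ l ∈ T, D l) ∩ ⋂ l ∈ Tᶜ, (D l)ᶜ).indicator (fun _ => g T) ω := by
    simp only [Set.indicator, hmem]
    simp
  simp_rw [hsum]
  rw [integral_finsetSum _ fun T _ => (integrable_const _).indicator (hm T)]
  exact Finset.sum_congr rfl fun T _ => by rw [integral_indicator_const _ (hm T), smul_eq_mul]

end JointIndicators

/-! ### Intervals and partitions of the half-line -/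

section HalfLine

instance : LocallyCompactSpace PosHalfLine := isOpen_Ioi.locallyCompactSpace

/-- The open interval of `(0, ∞)` with real end points `a`, `b`. -/
def openInterval (a b : ℝ) : Set PosHalfLine := {x | a < x ∧ x < b}

theorem isOpen_openInterval (a b : ℝ) : IsOpen (openInterval a b) :=
  (isOpen_lt continuous_const continuous_subtype_val).inter
    (isOpen_lt continuous_subtype_val continuous_const)

theorem ordConnected_openInterval (a b : ℝ) : (openInterval a b).OrdConnected :=
  ⟨fun _ hx _ hy _ hz => ⟨hx.1.trans_le hz.1, lt_of_le_of_lt (show _ ≤ _ from hz.2) hy.2⟩⟩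

theorem isFiniteUnionOpenIntervals_biUnion {ι : Type*} (T : Finset ι) {J : ι → Set PosHalfLine}
    (hJ : ∀ l, IsOpen (J l) ∧ (J l).OrdConnected) : IsFiniteUnionOpenIntervals (⋃ l ∈ T, J l) :=
  ⟨J '' T, T.finite_toSet.image J, by rintro _ ⟨l, _, rfl⟩; exact hJ l, by simp⟩

theorem IsFiniteUnionOpenIntervals.isOpen {I : Set PosHalfLine}
    (hI : IsFiniteUnionOpenIntervals I) : IsOpen I := by
  obtain ⟨F, _, hF, rfl⟩ := hI
  exact isOpen_sUnion fun J hJ => (hF J hJ).1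

theorem isFiniteUnionOpenIntervals_singleton {J : Set PosHalfLine}
    (hJ : IsOpen J) (hJ' : J.OrdConnected) : IsFiniteUnionOpenIntervals J :=
  ⟨{J}, Set.finite_singleton _, by simpa using ⟨hJ, hJ'⟩, by simp⟩

theorem isCompact_Icc_posHalfLine {a b : ℝ} (ha : 0 < a) :
    IsCompact {x : PosHalfLine | a ≤ x ∧ x ≤ b} := by
  have h : IsCompact ((Subtype.val : PosHalfLine → ℝ) ⁻¹' Set.Icc a b) :=
    (IsInducing.subtypeVal.isCompact_preimage_iff fun x hx =>
      ⟨⟨x, ha.trans_le hx.1⟩, rfl⟩).2 isCompact_Icc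
  exact h

variable {lam : Measure PosHalfLine} [IsLocallyFiniteMeasure lam]

theorem exists_openInterval_measure_lt (h0 : ∀ x, lam {x} = 0) (x : PosHalfLine) {η : ℝ≥0∞}
    (hη : η ≠ 0) : ∃ δ > 0, lam (openInterval (x - δ) (x + δ)) < η := by
  obtain ⟨U, hxU, hU, hlt⟩ := Set.exists_isOpen_lt_of_lt {x} η
    (by rw [h0]; exact pos_iff_ne_zero.2 hη)
  obtain ⟨δ, hδ, hball⟩ := Metric.isOpen_iff.1 hU x (hxU rfl)
  refine ⟨δ, hδ, (measure_mono fun y hy => hball ?_).trans_lt hlt⟩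
  rw [Metric.mem_ball, Subtype.dist_eq, Real.dist_eq, abs_lt]
  constructor <;> linarith [hy.1, hy.2]

/-- Cutting the support of finitely many test functions into small open intervals. -/
theorem exists_partition (h0 : ∀ x, lam {x} = 0) {κ : Type*} [Finite κ]
    (f : κ → C_c(PosHalfLine, ℝ)) :
    ∃ K : Set PosHalfLine, IsCompact K ∧ ∀ w : ℝ, 0 < w →
      ∃ (M : ℕ) (J : Fin M → Set PosHalfLine) (x : Fin M → PosHalfLine) (Z : Finset PosHalfLine),
        (∀ l, IsOpen (J l) ∧ (J l).OrdConnected) ∧ Pairwise (Function.onFun Disjoint J) ∧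
        (∀ l, lam (J l) ≤ ENNReal.ofReal w) ∧ (∀ l, J l ⊆ K) ∧
        (∀ i l, ∀ z ∈ J l, |f i z - f i (x l)| ≤ w) ∧
        ∀ i z, (∀ l, z ∉ J l) → z ∉ (Z : Set PosHalfLine) → f i z = 0 := by
  have hS : IsCompact (⋃ i, tsupport (f i)) := isCompact_iUnion fun i => (f i).hasCompactSupport
  have : Nonempty PosHalfLine := ⟨⟨1, Set.mem_Ioi.2 one_pos⟩⟩
  obtain ⟨a, ha⟩ := hS.bddBelow
  obtain ⟨c, hc⟩ := hS.bddAbove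
  have ha0 : (0 : ℝ) < a := a.2
  have hc0 : (0 : ℝ) < c := c.2
  -- The right end a + c instead of c gives K the positive length c even when the supports are empty
  -- and a, c are unrelated.
  set K : Set PosHalfLine := {x | (a : ℝ) ≤ x ∧ (x : ℝ) ≤ a + c} with hK
  have hKc : IsCompact K := isCompact_Icc_posHalfLine ha0
  have hf0 (i) (z : PosHalfLine) (hz : z ∉ K) : f i z = 0 := by
    by_contra h
    have hzS : z ∈ ⋃ i, tsupport (f i) := Set.mem_iUnion.2 ⟨i, subset_tsupport _ h⟩
    have h1 : (a : ℝ) ≤ z := ha hzS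
    have h2 : (z : ℝ) ≤ c := hc hzS
    exact hz ⟨h1, by linarith⟩
  -- K is fixed before w, so the total intensity of the cells stays bounded as w shrinks.
  refine ⟨K, hKc, fun w hw => ?_⟩
  have hnhd (x : PosHalfLine) : ∃ U : Set PosHalfLine, IsOpen U ∧ x ∈ U ∧
      lam U ≤ ENNReal.ofReal w ∧ ∀ i, ∀ z ∈ U, |f i z - f i x| < w / 2 := by
    obtain ⟨δ, hδ, hlt⟩ := exists_openInterval_measure_lt h0 x
      (η := ENNReal.ofReal w) (by simpa using hw)
    refine ⟨openInterval (x - δ) (x + δ) ∩ ⋂ i, {z | |f i z - f i x| < w / 2},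
      (isOpen_openInterval _ _).inter (isOpen_iInter_of_finite fun i => ?_), ⟨⟨?_, ?_⟩, ?_⟩, ?_, ?_⟩
    · exact isOpen_lt (((f i).continuous.sub continuous_const).abs) continuous_const
    · linarith
    · linarith
    · simpa using fun _ => hw
    · exact (measure_mono Set.inter_subset_left).trans hlt.le
    · intro i z hz
      exact Set.mem_iInter.1 hz.2 i
  choose U hUo hxU hUlam hUf using hnhd
  -- A mesh below the Lebesgue number puts each cell and its left end point into one `U x`;
  -- comparing both with `f i x` costs w/2 twice.
  obtain ⟨δ, hδ, hleb⟩ := lebesgue_number_lemma_of_metric hKc hUo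
    (fun x _ => Set.mem_iUnion.2 ⟨x, hxU x⟩)
  obtain ⟨M, hM⟩ := exists_nat_gt ((c : ℝ) / δ)
  have hM0 : (0 : ℝ) < M := (div_pos hc0 hδ).trans hM
  set h : ℝ := c / M with hh
  have hh0 : 0 < h := div_pos hc0 hM0
  have hhδ : h < δ := by rw [hh, div_lt_iff₀ hM0]; rwa [div_lt_iff₀ hδ, mul_comm] at hM
  have hMh : M * h = c := by rw [hh]; field_simp
  let pt (l : ℕ) : PosHalfLine := ⟨a + l * h, by have : 0 ≤ l * h := by positivity
                                                 exact add_pos_of_pos_of_nonneg ha0 this⟩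
  have hptK (l : ℕ) (hl : l ≤ M) : pt l ∈ K := by
    have h1 : (l : ℝ) * h ≤ M * h := by gcongr
    have h2 : 0 ≤ (l : ℝ) * h := by positivity
    exact ⟨by simpa [pt] using h2, by simp only [pt]; linarith⟩
  set J : Fin M → Set PosHalfLine := fun l => openInterval (a + l * h) (a + (l + 1) * h) with hJ
  have hJball (l : Fin M) : J l ⊆ Metric.ball (pt l) δ := by
    intro z hz
    have h1 := hz.1
    have h2 := hz.2
    rw [Metric.mem_ball, Subtype.dist_eq, Real.dist_eq, abs_lt]
    simp only [pt]
    constructor <;> linarith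
  have hJU (l : Fin M) : ∃ x, J l ⊆ U x ∧ pt l ∈ U x := by
    obtain ⟨x, hx⟩ := hleb (pt l) (hptK l l.2.le)
    exact ⟨x, (hJball l).trans hx, hx (Metric.mem_ball_self hδ)⟩
  refine ⟨M, J, fun l => pt l, (Finset.range (M + 1)).image pt, fun l =>
    ⟨isOpen_openInterval _ _, ordConnected_openInterval _ _⟩, ?_, fun l => ?_, fun l z hz => ?_,
    fun i l z hz => ?_, fun i z hzJ hzZ => ?_⟩
  · have key : ∀ l m : Fin M, l < m → Disjoint (J l) (J m) := by
      intro l m hlm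
      refine Set.disjoint_left.2 fun z hz1 hz2 => ?_
      have h1 := hz1.2
      have h2 := hz2.1
      have h3 : ((l : ℕ) : ℝ) + 1 ≤ (m : ℕ) := by exact_mod_cast hlm
      have h4 := mul_le_mul_of_nonneg_right h3 hh0.le
      linarith
    intro l m hlm
    rcases lt_or_gt_of_ne hlm with h | h
    · exact key l m h
    · exact (key m l h).symm
  · obtain ⟨x, hx, _⟩ := hJU l
    exact (measure_mono hx).trans (hUlam x)
  · have h1 := hz.1
    have h2 := hz.2
    have h3 : ((l : ℕ) : ℝ) + 1 ≤ M := by exact_mod_cast l.2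
    have h4 := mul_le_mul_of_nonneg_right h3 hh0.le
    have h5 : 0 ≤ ((l : ℕ) : ℝ) * h := by positivity
    exact ⟨by linarith, by linarith⟩
  · obtain ⟨x, hx, hp⟩ := hJU l
    have h1 := hUf x i z (hx hz)
    have h2 := hUf x i _ hp
    rw [abs_lt] at h1 h2
    rw [abs_le]
    constructor <;> linarith [h1.1, h1.2, h2.1, h2.2]
  · by_contra hne
    have hzK : z ∈ K := by_contra fun h => hne (hf0 i z h)
    have hpos : 0 ≤ ((z : ℝ) - a) / h := div_nonneg (by linarith [hzK.1]) hh0.le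
    set l := ⌊((z : ℝ) - a) / h⌋₊ with hl
    have h1 : (l : ℝ) * h ≤ z - a := (le_div_iff₀ hh0).1 (Nat.floor_le hpos)
    have h2 : (z : ℝ) - a < (l + 1) * h := (div_lt_iff₀ hh0).1 (Nat.lt_floor_add_one _)
    have hne' (m : ℕ) (hm : m ≤ M) : (z : ℝ) ≠ a + m * h := fun hz => hzZ (by
      simp only [Finset.coe_image, Set.mem_image, Finset.mem_coe, Finset.mem_range]
      exact ⟨m, by omega, Subtype.ext hz.symm⟩)
    -- The floor l names the cell of z; l ≥ M is possible only at the right end of K, which is the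
    -- excluded point `pt M`.
    rcases lt_or_ge l M with hlM | hlM
    · refine hzJ ⟨l, hlM⟩ ⟨?_, ?_⟩
      · exact lt_of_le_of_ne (by simp only; linarith) (hne' l hlM.le).symm
      · simp only; linarith
    · have h3 : (M : ℝ) * h ≤ l * h := by gcongr
      exact hne' M le_rfl (le_antisymm (by linarith [hzK.2]) (by linarith))

end HalfLine

/-! ### Means, void probabilities and integrality of Poisson counts -/

section PoissonFacts

theorem lintegral_natCast_poissonMeasure (r : ℝ≥0) :
    ∫⁻ k, (k : ℝ≥0∞) ∂poissonMeasure r = r := by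
  have h1 : ∫⁻ k, (k : ℝ≥0∞) ∂poissonMeasure r
      = ∑' k : ℕ, (k : ℝ≥0∞) * ENNReal.ofReal (Real.exp (-r) * r ^ k / k.factorial) := by
    rw [lintegral_countable']
    simp_rw [poissonMeasure_singleton]
  rw [h1, tsum_eq_zero_add' ENNReal.summable]
  have h2 (k : ℕ) : ((k + 1 : ℕ) : ℝ≥0∞) *
      ENNReal.ofReal (Real.exp (-r) * r ^ (k + 1) / (k + 1).factorial) =
      r * ENNReal.ofReal (Real.exp (-r) * r ^ k / k.factorial) := by
    rw [← ENNReal.ofReal_natCast, ← ENNReal.ofReal_coe_nnreal, ← ENNReal.ofReal_mul (by positivity),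
      ← ENNReal.ofReal_mul (by positivity)]
    congr 1
    rw [Nat.factorial_succ]
    push_cast
    field_simp
    ring
  simp_rw [h2]
  rw [ENNReal.tsum_mul_left, ← ENNReal.ofReal_tsum_of_nonneg (fun k => by positivity)
    (hasSum_one_poissonMeasure r).summable, (hasSum_one_poissonMeasure r).tsum_eq]
  simp

variable {Ω E : Type*} [MeasurableSpace Ω] [TopologicalSpace E] [MeasurableSpace E]
  {lam : Measure E} {N : Ω → LocFinMeasure E} {P : Measure Ω}

namespace IsPoissonRandomMeasure

theorem ae_exists_nat (h : IsPoissonRandomMeasure lam N P) {B : Set E} (hB : MeasurableSet B)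
    (hfin : lam B < ∞) : ∀ᵐ ω ∂P, ∃ k : ℕ, (N ω).toMeasure B = k := by
  have hl := h.law B hB hfin
  have hms : MeasurableSet {x : ℝ≥0∞ | ∃ k : ℕ, x = k} := by
    have : {x : ℝ≥0∞ | ∃ k : ℕ, x = k} = Set.range (Nat.cast : ℕ → ℝ≥0∞) := by
      ext x; simp [eq_comm]
    rw [this]
    exact (Set.countable_range _).measurableSet
  refine (hl.ae_iff (measurableSet_setOfPred.1 hms)).2 ?_
  rw [ae_map_iff (by fun_prop) hms]
  exact ae_of_all _ fun k => ⟨k, rfl⟩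

theorem measureReal_void (h : IsPoissonRandomMeasure lam N P) {B : Set E} (hB : MeasurableSet B)
    (hfin : lam B < ∞) :
    P.real {ω | (N ω).toMeasure B = 0} = Real.exp (-(lam B).toReal) := by
  have hl := h.law B hB hfin
  rw [hl.measureReal_eq (p := fun x => x = 0) (measurableSet_singleton 0), measureReal_def,
    Measure.map_apply (s := {x : ℝ≥0∞ | x = 0}) (by fun_prop) (measurableSet_singleton 0)]
  have : (Nat.cast : ℕ → ℝ≥0∞) ⁻¹' {x | x = 0} = {0} := by ext k; simp
  rw [this, ← measureReal_def, poissonMeasure_real_singleton]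
  simp [ENNReal.coe_toNNReal_eq_toReal]

theorem lintegral_apply (h : IsPoissonRandomMeasure lam N P) {B : Set E} (hB : MeasurableSet B)
    (hfin : lam B < ∞) : ∫⁻ ω, (N ω).toMeasure B ∂P = lam B := by
  have hl := h.law B hB hfin
  have := hl.lintegral_comp (f := id) aemeasurable_id
  simp only [id] at this
  rw [this, lintegral_map (f := fun x => x) measurable_id' (by fun_prop), lintegral_natCast_poissonMeasure,
    ENNReal.coe_toNNReal hfin.ne]

end IsPoissonRandomMeasure

end PoissonFacts

/-! ### From void probabilities and means to weak convergence -/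

section Convergence

open scoped Classical in
/-- Convergence to a Poisson random measure without fixed atoms on `(0, ∞)` follows from the
convergence of void probabilities and of means on finite unions of open intervals. -/
theorem tendstoInDistribution_of_void {Ω' : Type*} {Ω : ℕ → Type*} [∀ n, MeasurableSpace (Ω n)]
    {P : ∀ n, Measure (Ω n)} [∀ n, IsProbabilityMeasure (P n)] [MeasurableSpace Ω']
    {P' : Measure Ω'} [IsProbabilityMeasure P'] {lam : Measure PosHalfLine}
    [IsLocallyFiniteMeasure lam] (h0 : ∀ x, lam {x} = 0)
    {ξ : ∀ n, Ω n → LocFinMeasure PosHalfLine} (hξ : ∀ n, Measurable (ξ n))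
    {N : Ω' → LocFinMeasure PosHalfLine} (hN : IsPoissonRandomMeasure lam N P')
    (hcount : ∀ n B, MeasurableSet B → ∀ᵐ ω ∂P n, ∃ k : ℕ, (ξ n ω).toMeasure B = k)
    (hvoid : ∀ I, IsFiniteUnionOpenIntervals I → lam I < ∞ → Tendsto
      (fun n => (P n).real {ω | (ξ n ω).toMeasure I = 0}) atTop
      (𝓝 (Real.exp (-(lam I).toReal))))
    (hmean : ∀ I, IsFiniteUnionOpenIntervals I → lam I < ∞ → Tendsto
      (fun n => ∫⁻ ω, (ξ n ω).toMeasure I ∂P n) atTop (𝓝 (lam I))) :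
    TendstoInDistribution ξ atTop N P P' := by
  have hξm (n) : Measurable fun ω => (ξ n ω).toMeasure :=
    LocFinMeasure.measurable_toMeasure.comp (hξ n)
  have hNm : Measurable fun ω => (N ω).toMeasure :=
    LocFinMeasure.measurable_toMeasure.comp hN.measurable
  refine ⟨fun n => (hξ n).aemeasurable, hN.measurable.aemeasurable, ?_⟩
  obtain ⟨F, hF⟩ := LocFinMeasure.exists_isInducing (E := PosHalfLine)
  refine tendsto_probabilityMeasure_of_isInducing_pi hF fun s L ⟨B, hB⟩ ⟨K, hL⟩ => ?_
  have hgm : Measurable fun μ : LocFinMeasure PosHalfLine =>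
      L (s.restrict fun i => ∫ x, F i x ∂μ.toMeasure) :=
    hL.continuous.measurable.comp (measurable_pi_lambda _ fun i : s =>
      (LocFinMeasure.continuous_integral (F i)).measurable)
  simp only [ProbabilityMeasure.coe_mk]
  rw [integral_map hN.measurable.aemeasurable hgm.aestronglyMeasurable]
  simp_rw [fun n => integral_map (hξ n).aemeasurable hgm.aestronglyMeasurable]
  let f : s → C_c(PosHalfLine, ℝ) := fun i => F i
  change Tendsto (fun n => ∫ ω, L (fun i => ∫ x, f i x ∂(ξ n ω).toMeasure) ∂P n) atTop
    (𝓝 (∫ ω, L (fun i => ∫ x, f i x ∂(N ω).toMeasure) ∂P'))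
  have hB0 : 0 ≤ B := dist_nonneg.trans (hB 0 0)
  obtain ⟨Kc, hKc, hpart⟩ := exists_partition h0 f
  set Λ : ℝ := lam.real Kc
  have hΛ : 0 ≤ Λ := measureReal_nonneg
  rw [Metric.tendsto_nhds]
  intro ε hε
  -- Both discretization errors are eventually below ε/4, since in the limit they are at most (B +
  -- K)Λw; a further ε/4 goes to the discretized functionals.
  set w : ℝ := ε / (4 * ((B + K) * Λ + 1)) with hw
  have hBK : 0 ≤ (B + K) * Λ := by positivity
  have hw0 : 0 < w := by positivity
  obtain ⟨M, J, x, Z, hJ, hd, hJw, hJK, hosc, hf0⟩ := hpart w hw0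
  have hJm (l) : MeasurableSet (J l) := (hJ l).1.measurableSet
  have hZm : MeasurableSet (Z : Set PosHalfLine) := Z.measurableSet
  have hJfin (l) : lam (J l) < ∞ := (hJw l).trans_lt ENNReal.ofReal_lt_top
  have hlamZ : lam Z = 0 := by
    rw [← Set.biUnion_of_singleton (Z : Set PosHalfLine)]
    exact (measure_biUnion_null_iff Z.countable_toSet).2 fun z _ => h0 z
  have hJI (l) := isFiniteUnionOpenIntervals_singleton (hJ l).1 (hJ l).2
  -- means of the atoms
  have hpoint (z : PosHalfLine) : Tendsto (fun n => ∫⁻ ω, (ξ n ω).toMeasure {z} ∂P n) atTop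
      (𝓝 0) := by
    refine ENNReal.tendsto_nhds_zero.2 fun η hη => ?_
    -- The hypotheses say nothing about single points, so the mean at z is bounded by that of a
    -- small interval around it.
    obtain ⟨δ, hδ, hlt⟩ := exists_openInterval_measure_lt h0 z hη.ne'
    have hlim := hmean _ (isFiniteUnionOpenIntervals_singleton (isOpen_openInterval _ _)
      (ordConnected_openInterval _ _)) (hlt.trans_le le_top)
    filter_upwards [hlim.eventually (gt_mem_nhds hlt)] with n hn
    refine (lintegral_mono fun ω => measure_mono ?_).trans hn.le
    rintro _ rfl
    exact ⟨by linarith, by linarith⟩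
  have hZmean : Tendsto (fun n => ∫⁻ ω, (ξ n ω).toMeasure Z ∂P n) atTop (𝓝 0) := by
    have hsum := tendsto_finsetSum Z fun z _ => hpoint z
    simp only [Finset.sum_const_zero] at hsum
    refine tendsto_of_tendsto_of_tendsto_of_le_of_le tendsto_const_nhds hsum
      (fun n => zero_le) fun n => ?_
    have hm (z : PosHalfLine) : Measurable fun ω => (ξ n ω).toMeasure {z} :=
      (Measure.measurable_coe (measurableSet_singleton z)).comp (hξm n)
    simp only
    rw [← lintegral_finsetSum _ fun z _ => hm z]
    refine lintegral_mono fun ω => ?_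
    simp
  -- discretized functionals
  let g (T : Finset (Fin M)) : ℝ := L fun i => ∑ l, if l ∈ T then 0 else f i (x l)
  have hDm (n l) : MeasurableSet {ω | (ξ n ω).toMeasure (J l) = 0} :=
    ((Measure.measurable_coe (hJm l)).comp (hξm n)) (measurableSet_singleton 0)
  have hDm' (l) : MeasurableSet {ω | (N ω).toMeasure (J l) = 0} :=
    ((Measure.measurable_coe (hJm l)).comp hNm) (measurableSet_singleton 0)
  have hG : Tendsto (fun n => ∫ ω, L (fun i => ∑ l, if (ξ n ω).toMeasure (J l) = 0 then 0
      else f i (x l)) ∂P n) atTop (𝓝 (∫ ω, L (fun i => ∑ l, if (N ω).toMeasure (J l) = 0 then 0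
      else f i (x l)) ∂P')) := by
    have e1 := integral_indicators_eq_sum (P := P') hDm' g
    have e2 (n) := integral_indicators_eq_sum (P := P n) (hDm n) g
    simp only [g, Finset.mem_filter, Finset.mem_univ, true_and, Set.mem_ofPred_eq] at e1 e2
    rw [e1]
    simp_rw [e2]
    refine tendsto_finsetSum _ fun T _ => Tendsto.mul_const _ ?_
    refine tendsto_measureReal_inter_compl (P := P) (P' := P') hDm hDm' (fun T => ?_) T _
    have hTI := isFiniteUnionOpenIntervals_biUnion T hJ
    have hTfin : lam (⋃ l ∈ T, J l) < ∞ :=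
      measure_biUnion_lt_top T.finite_toSet fun l _ => hJfin l
    -- Joint emptiness of cells is emptiness of their union, again a finite union of open intervals:
    -- this is where void probabilities of unions are needed.
    have eT (μ : Measure PosHalfLine) : (∀ l ∈ T, μ (J l) = 0) ↔ μ (⋃ l ∈ T, J l) = 0 :=
      (measure_biUnion_null_iff T.countable_toSet).symm
    have := hvoid _ hTI hTfin
    rw [← hN.measureReal_void hTI.isOpen.measurableSet hTfin] at this
    simpa only [← eT, Set.ofPred_forall] using this
  -- error terms
  have herr (l) : Tendsto (fun n => (∫⁻ ω, (ξ n ω).toMeasure (J l) ∂P n).toReal) atTop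
      (𝓝 (lam (J l)).toReal) :=
    (ENNReal.tendsto_toReal (hJfin l).ne).comp (hmean _ (hJI l) (hJfin l))
  have hsmall : B * (∑ l, ((lam (J l)).toReal - 1 + Real.exp (-(lam (J l)).toReal)) + 0) +
      K * w * ∑ l, (lam (J l)).toReal < ε / 4 := by
    have h1 (l) : (lam (J l)).toReal - 1 + Real.exp (-(lam (J l)).toReal) ≤
        w * (lam (J l)).toReal := by
      have ha := abs_le.1 (abs_one_sub_sub_exp_neg_le (ENNReal.toReal_nonneg (a := lam (J l))))
      have hb : (lam (J l)).toReal ≤ w := ENNReal.toReal_le_of_le_ofReal hw0.le (hJw l)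
      have hc := mul_le_mul_of_nonneg_right hb (ENNReal.toReal_nonneg (a := lam (J l)))
      linarith [ha.1]
    have h2 : ∑ l, (lam (J l)).toReal ≤ Λ := by
      have : ∑ l, lam.real (J l) = lam.real (⋃ l ∈ Finset.univ, J l) :=
        (measureReal_biUnion_finset (fun i _ j _ hij => hd hij) (fun l _ => hJm l)
          (fun l _ => (hJfin l).ne)).symm
      refine this.le.trans (measureReal_mono ?_ hKc.measure_lt_top.ne)
      simpa using hJK
    have h3 : ∑ l, ((lam (J l)).toReal - 1 + Real.exp (-(lam (J l)).toReal)) ≤ w * Λ := by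
      refine (Finset.sum_le_sum fun l _ => h1 l).trans ?_
      rw [← Finset.mul_sum]; gcongr
    calc _ ≤ B * (w * Λ + 0) + K * w * Λ := by gcongr
      _ = (B + K) * Λ * w := by ring
      _ < ((B + K) * Λ + 1) * w := by nlinarith
      _ = ε / 4 := by rw [hw]; field_simp
  have hlimerr : Tendsto (fun n => B * (∑ l, ((∫⁻ ω, (ξ n ω).toMeasure (J l) ∂P n).toReal - 1 +
      (P n).real {ω | (ξ n ω).toMeasure (J l) = 0}) + (∫⁻ ω, (ξ n ω).toMeasure Z ∂P n).toReal) +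
      K * w * ∑ l, (∫⁻ ω, (ξ n ω).toMeasure (J l) ∂P n).toReal) atTop
      (𝓝 (B * (∑ l, ((lam (J l)).toReal - 1 + Real.exp (-(lam (J l)).toReal)) + 0) +
      K * w * ∑ l, (lam (J l)).toReal)) := by
    have hz := (ENNReal.tendsto_toReal ENNReal.zero_ne_top).comp hZmean
    rw [ENNReal.toReal_zero] at hz
    exact (((tendsto_finsetSum _ fun l _ => ((herr l).sub_const 1).add
      (hvoid _ (hJI l) (hJfin l))).add hz).const_mul B).add
      ((tendsto_finsetSum _ fun l _ => herr l).const_mul (K * w))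
  have hfinJ : ∀ᶠ n in atTop, ∀ l, ∫⁻ ω, (ξ n ω).toMeasure (J l) ∂P n ≠ ∞ :=
    eventually_all.2 fun l => ((hmean _ (hJI l) (hJfin l)).eventually
      (gt_mem_nhds (hJfin l))).mono fun n hn => hn.ne
  have hfinZ : ∀ᶠ n in atTop, ∫⁻ ω, (ξ n ω).toMeasure Z ∂P n ≠ ∞ :=
    (hZmean.eventually (gt_mem_nhds ENNReal.zero_lt_top)).mono fun n hn => hn.ne
  have hNerr := abs_integral_sub_integral_discretization_le hNm (P := P') hJm hZm hd
    (fun l => hN.ae_exists_nat (hJm l) (hJfin l)) (hN.ae_exists_nat hZm (by simp [hlamZ]))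
    (fun l => by rw [hN.lintegral_apply (hJm l) (hJfin l)]; exact (hJfin l).ne)
    (by rw [hN.lintegral_apply hZm (by simp [hlamZ])]; simp [hlamZ]) hf0 hw0.le hosc hB hL
  simp only [fun l => hN.lintegral_apply (hJm l) (hJfin l),
    hN.lintegral_apply hZm (by simp [hlamZ] : lam Z < ∞), hlamZ, ENNReal.toReal_zero,
    fun l => hN.measureReal_void (hJm l) (hJfin l)] at hNerr
  filter_upwards [hfinJ, hfinZ, hlimerr.eventually (gt_mem_nhds hsmall),
    Metric.tendsto_nhds.1 hG (ε / 4) (by positivity)] with n hn1 hn2 hn3 hn4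
  have hnerr := abs_integral_sub_integral_discretization_le (hξm n) (P := P n) hJm hZm hd
    (fun l => hcount n _ (hJm l)) (hcount n _ hZm) hn1 hn2 hf0 hw0.le hosc hB hL
  rw [Real.dist_eq, abs_lt] at hn4 ⊢
  have a1 := abs_lt.1 (hnerr.trans_lt hn3)
  have a2 := abs_lt.1 (hNerr.trans_lt hsmall)
  constructor <;> linarith [a1.1, a1.2, a2.1, a2.2, hn4.1, hn4.2]

end Convergence

/-! ### Countable sums of Poisson variables and grouping of independent families -/

section PoissonSums

/-- Dominated convergence for the mass functions: once the parameter is below r₀ + 1, the terms are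
at most (r₀ + 1)^k / k!. -/
theorem tendsto_poissonMeasure_real {r : ℕ → ℝ≥0} {r₀ : ℝ≥0} (hr : Tendsto r atTop (𝓝 r₀))
    (A : Set ℕ) :
    Tendsto (fun n => (poissonMeasure (r n)).real A) atTop (𝓝 ((poissonMeasure r₀).real A)) := by
  have key (s : ℝ≥0) : (poissonMeasure s).real A =
      ∑' k : ℕ, (Real.exp (-s) * s ^ k / k.factorial) * A.indicator 1 k := by
    rw [← integral_indicator_one A.to_countable.measurableSet, integral_poissonMeasure]
    simp
  simp_rw [key]
  have hr' : Tendsto (fun n => (r n : ℝ)) atTop (𝓝 r₀) := NNReal.tendsto_coe.2 hr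
  refine tendsto_tsum_of_dominated_convergence
    (bound := fun k : ℕ => ((r₀ : ℝ) + 1) ^ k / k.factorial) (Real.summable_pow_div_factorial _)
    (fun k => ?_) ?_
  · refine Tendsto.mul_const _ (Tendsto.div_const ?_ _)
    exact ((Real.continuous_exp.tendsto _).comp hr'.neg).mul (hr'.pow k)
  · filter_upwards [hr'.eventually (eventually_le_nhds (lt_add_one (r₀ : ℝ)))] with n hn k
    have h1 : Real.exp (-(r n)) ≤ 1 := Real.exp_le_one_iff.2 (by simp)
    have h2 : ‖A.indicator (1 : ℕ → ℝ) k‖ ≤ 1 := by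
      by_cases hk : k ∈ A <;> simp [hk]
    rw [norm_mul, Real.norm_of_nonneg (by positivity)]
    calc Real.exp (-(r n)) * r n ^ k / k.factorial * ‖A.indicator (1 : ℕ → ℝ) k‖
        ≤ 1 * ((r₀ : ℝ) + 1) ^ k / k.factorial * 1 := by gcongr
      _ = _ := by ring

variable {Ω : Type*} [MeasurableSpace Ω] {P : Measure Ω} [IsProbabilityMeasure P]

/-- A countable sum of independent Poisson variables is Poisson. -/
theorem hasLaw_tsum_poisson {X : ℕ → Ω → ℝ≥0∞} (hX : ∀ k, Measurable (X k)) {r : ℕ → ℝ≥0}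
    (hlaw : ∀ k, HasLaw (X k) ((poissonMeasure (r k)).map (Nat.cast : ℕ → ℝ≥0∞)) P)
    (hind : iIndepFun X P) {r₀ : ℝ≥0} (hr : HasSum r r₀) :
    HasLaw (fun ω => ∑' k, X k ω) ((poissonMeasure r₀).map (Nat.cast : ℕ → ℝ≥0∞)) P := by
  have hS (n : ℕ) : HasLaw (∑ k ∈ Finset.range n, X k)
      ((poissonMeasure (∑ k ∈ Finset.range n, r k)).map (Nat.cast : ℕ → ℝ≥0∞)) P := by
    induction n with
    | zero =>
      refine ⟨(measurable_zero : Measurable (0 : Ω → ℝ≥0∞)).aemeasurable, ?_⟩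
      have h0 : poissonMeasure 0 = Measure.dirac 0 := by
        refine Measure.ext_of_singleton fun k => ?_
        rw [poissonMeasure_singleton]
        rcases Nat.eq_zero_or_pos k with rfl | hk
        · simp
        · simp [hk.ne', hk.ne]
      simp only [Finset.range_zero, Finset.sum_empty, h0]
      rw [Measure.map_dirac' (measurable_from_nat (f := (Nat.cast : ℕ → ℝ≥0∞))), Nat.cast_zero]
      exact (Measure.map_const P (0 : ℝ≥0∞)).trans (by simp)
    | succ n ih =>
      rw [Finset.sum_range_succ, Finset.sum_range_succ]
      exact (hind.indepFun_sum_range_succ hX n).hasLaw_add_map_cast_poissonMeasure ih (hlaw n)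
  have hm : Measurable fun ω => ∑' k, X k ω := Measurable.tsum hX
  refine ⟨hm.aemeasurable, ?_⟩
  -- Partial sums increase, so {sum ≤ a} is a decreasing intersection; the same probabilities
  -- converge by continuity of the Poisson law in its parameter.
  refine Measure.ext_of_Iic _ _ fun a => ?_
  have h1 : Tendsto (fun n => P {ω | (∑ k ∈ Finset.range n, X k) ω ≤ a}) atTop
      (𝓝 (P {ω | ∑' k, X k ω ≤ a})) := by
    have hset : {ω | ∑' k, X k ω ≤ a} = ⋂ n, {ω | (∑ k ∈ Finset.range n, X k) ω ≤ a} := by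
      ext ω
      simp only [Set.mem_ofPred_eq, Set.mem_iInter, Finset.sum_apply]
      exact ⟨fun h n => (ENNReal.sum_le_tsum _).trans h,
        fun h => le_of_tendsto' ENNReal.summable.hasSum.tendsto_sum_nat h⟩
    rw [hset]
    refine tendsto_measure_iInter_atTop (fun n => ?_) ?_ ⟨0, measure_ne_top _ _⟩
    · simp only [Finset.sum_apply]
      exact (measurableSet_le (Finset.measurable_fun_sum _ fun k _ => hX k)
        measurable_const).nullMeasurableSet
    · intro n m hnm ω hω
      simp only [Set.mem_ofPred_eq, Finset.sum_apply] at hω ⊢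
      exact (Finset.sum_le_sum_of_subset (Finset.range_subset_range.2 hnm)).trans hω
  have h2 (s : ℝ≥0) : (poissonMeasure s).map (Nat.cast : ℕ → ℝ≥0∞) (Set.Iic a) =
      poissonMeasure s (Nat.cast ⁻¹' Set.Iic a) :=
    Measure.map_apply (by fun_prop) measurableSet_Iic
  have h3 : Tendsto (fun n => P {ω | (∑ k ∈ Finset.range n, X k) ω ≤ a}) atTop
      (𝓝 ((poissonMeasure r₀).map (Nat.cast : ℕ → ℝ≥0∞) (Set.Iic a))) := by
    rw [h2]
    have := tendsto_poissonMeasure_real hr.tendsto_sum_nat ((Nat.cast : ℕ → ℝ≥0∞) ⁻¹' Set.Iic a)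
    have h4 := (ENNReal.continuous_ofReal.tendsto _).comp this
    simp only [Function.comp_def, measureReal_def, ENNReal.ofReal_toReal (measure_ne_top _ _)] at h4
    refine h4.congr fun n => ?_
    rw [← h2]
    exact ((hS n).measure_eq (p := fun x => x ≤ a) measurableSet_Iic).symm
  rw [Measure.map_apply hm measurableSet_Iic]
  exact tendsto_nhds_unique h1 h3

/-- Grouping a doubly indexed independent family along one index. -/
theorem iIndepFun_curry {ι κ S : Type*} [Countable ι] [Countable κ] [MeasurableSpace S]
    {X : ι → κ → Ω → S} (hX : ∀ i k, Measurable (X i k))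
    (h : iIndepFun (fun (p : ι × κ) ω => X p.1 p.2 ω) P) :
    iIndepFun (fun i ω k => X i k ω) P := by
  have hprob (i : ι) (k : κ) : IsProbabilityMeasure (P.map (X i k)) :=
    Measure.isProbabilityMeasure_map (hX i k).aemeasurable
  have hrow (i : ι) : P.map (fun ω k => X i k ω) = Measure.infinitePi fun k => P.map (X i k) :=
    (iIndepFun_iff_map_fun_eq_infinitePi_map fun k => hX i k).1
      (h.precomp (g := fun k => (i, k)) (Prod.mk_right_injective i))
  rw [iIndepFun_iff_map_fun_eq_infinitePi_map fun i => measurable_pi_lambda _ fun k => hX i k]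
  simp_rw [hrow]
  rw [← Measure.infinitePi_map_curry (fun i k => P.map (X i k)),
    ← (iIndepFun_iff_map_fun_eq_infinitePi_map fun p : ι × κ => hX p.1 p.2).1 h,
    Measure.map_map (by fun_prop) (measurable_pi_lambda _ fun p : ι × κ => hX p.1 p.2)]
  rfl

end PoissonSums

/-! ### Poisson samples from a finite measure -/

section CompoundPoisson

variable {E : Type*} [MeasurableSpace E]

/-- The law of a Poisson number of points together with an independent i.i.d. sequence. -/
noncomputable def markedPoisson (c : ℝ≥0) (ν : Measure E) : Measure (ℕ × (ℕ → E)) :=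
  (poissonMeasure c).prod (Measure.infinitePi fun _ : ℕ => ν)

/-- The number of the first `τ` points that lie in `B`. -/
noncomputable def pointCount (B : Set E) (ω : ℕ × (ℕ → E)) : ℕ :=
  ∑ j ∈ Finset.range ω.1, B.indicator 1 (ω.2 j)

theorem measurable_pointCount {B : Set E} (hB : MeasurableSet B) : Measurable (pointCount B) := by
  refine measurable_from_prod_countable_right fun n => ?_
  have h1 : Measurable (B.indicator (1 : E → ℕ)) := measurable_one.indicator hB
  change Measurable fun Y : ℕ → E => ∑ j ∈ Finset.range n, B.indicator 1 (Y j)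
  exact Finset.measurable_fun_sum _ fun j _ => h1.comp (measurable_pi_apply j)

variable {c : ℝ≥0} {ν : Measure E} [IsProbabilityMeasure ν]

instance : IsProbabilityMeasure (markedPoisson c ν) := by
  unfold markedPoisson; infer_instance

theorem integral_infinitePi_prod_range {h : E → ℂ} (hm : Measurable h) (n : ℕ) :
    ∫ Y : ℕ → E, ∏ j ∈ Finset.range n, h (Y j) ∂Measure.infinitePi (fun _ : ℕ => ν) =
      (∫ x, h x ∂ν) ^ n := by
  have h1 := integral_restrict_infinitePi (fun _ : ℕ => ν) (s := Finset.range n)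
    (f := fun y => ∏ j, h (y j)) (Finset.measurable_fun_prod _ fun j _ =>
      hm.comp (measurable_pi_apply j)).aestronglyMeasurable
  rw [integral_fintype_prod_eq_prod (fun _ => h)] at h1
  simp only [Finset.prod_const, Finset.card_univ, Fintype.card_coe, Finset.card_range] at h1
  rw [← h1]
  refine integral_congr_ae (ae_of_all _ fun Y => ?_)
  exact (Finset.prod_coe_sort (Finset.range n) fun j => h (Y j)).symm

/-- Given n points the mean is z^n with z = ∫ h dν, and the Poisson generating function at z is
exp(c(z - 1)). -/
theorem integral_markedPoisson_prod {h : E → ℂ} (hm : Measurable h) (hb : ∀ x, ‖h x‖ ≤ 1) :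
    ∫ ω, ∏ j ∈ Finset.range ω.1, h (ω.2 j) ∂markedPoisson c ν =
      Complex.exp (c * (∫ x, h x ∂ν - 1)) := by
  have hmeas : Measurable fun ω : ℕ × (ℕ → E) => ∏ j ∈ Finset.range ω.1, h (ω.2 j) :=
    measurable_from_prod_countable_right fun n =>
      show Measurable fun Y : ℕ → E => ∏ j ∈ Finset.range n, h (Y j) from
        Finset.measurable_fun_prod _ fun j _ => hm.comp (measurable_pi_apply j)
  have hint : Integrable (fun ω : ℕ × (ℕ → E) => ∏ j ∈ Finset.range ω.1, h (ω.2 j))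
      ((poissonMeasure c).prod (Measure.infinitePi fun _ : ℕ => ν)) :=
    Integrable.of_bound hmeas.aestronglyMeasurable 1 (ae_of_all _ fun ω => by
      rw [norm_prod]; exact Finset.prod_le_one (fun _ _ => norm_nonneg _) fun j _ => hb _)
  rw [markedPoisson, integral_prod _ hint]
  simp only [integral_infinitePi_prod_range hm]
  set z := ∫ x, h x ∂ν
  rw [integral_poissonMeasure]
  have h2 (n : ℕ) : (Real.exp (-c) * (c : ℝ) ^ n / n.factorial) • z ^ n =
      Complex.exp (-c) * ((c * z) ^ n / n.factorial) := by
    rw [Complex.real_smul]; push_cast; rw [mul_pow]; ring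
  simp_rw [h2]
  rw [tsum_mul_left, (NormedSpace.expSeries_div_hasSum_exp ((c : ℂ) * z)).tsum_eq,
    ← Complex.exp_eq_exp_ℂ, ← Complex.exp_add]
  ring_nf

/-- The exponential is a product over the sample points of h. Disjointness turns h - 1 into a sum
over i, so the generating function factorizes; both the law of one count and the independence of
several are read off from this formula. -/
theorem integral_exp_pointCount {ι : Type*} [Fintype ι] {B : ι → Set E}
    (hB : ∀ i, MeasurableSet (B i)) (hd : Pairwise (Function.onFun Disjoint B)) (t : ι → ℝ) :
    ∫ ω, Complex.exp ((∑ i, (pointCount (B i) ω : ℝ) * t i : ℝ) * Complex.I) ∂markedPoisson c ν =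
      ∏ i, Complex.exp ((c * ν.real (B i) : ℝ) * (Complex.exp (t i * Complex.I) - 1)) := by
  set h : E → ℂ := fun x =>
    Complex.exp ((∑ i, (B i).indicator (fun _ => t i) x : ℝ) * Complex.I) with hh
  have hm : Measurable h := by
    have : Measurable fun x => ∑ i, (B i).indicator (fun _ => t i) x :=
      Finset.measurable_fun_sum _ fun i _ => measurable_const.indicator (hB i)
    exact (Complex.continuous_exp.measurable.comp
      ((Complex.continuous_ofReal.measurable.comp this).mul_const Complex.I))
  have hb (x) : ‖h x‖ ≤ 1 := (Complex.norm_exp_ofReal_mul_I _).le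
  have hprod (ω : ℕ × (ℕ → E)) :
      Complex.exp ((∑ i, (pointCount (B i) ω : ℝ) * t i : ℝ) * Complex.I) =
      ∏ j ∈ Finset.range ω.1, h (ω.2 j) := by
    simp only [hh]
    rw [← Complex.exp_sum, ← Finset.sum_mul, ← Complex.ofReal_sum, Finset.sum_comm]
    congr 3
    refine Finset.sum_congr rfl fun i _ => ?_
    rw [pointCount, Nat.cast_sum, Finset.sum_mul]
    refine Finset.sum_congr rfl fun j _ => ?_
    by_cases hx : ω.2 j ∈ B i <;> simp [hx]
  simp_rw [hprod]
  rw [integral_markedPoisson_prod hm hb, ← Complex.exp_sum]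
  congr 1
  have hsub (x : E) : h x = 1 + ∑ i, (B i).indicator
      (fun _ => Complex.exp (t i * Complex.I) - 1) x := by
    by_cases hx : ∃ i, x ∈ B i
    · obtain ⟨i, hi⟩ := hx
      have hne (k) (hk : k ≠ i) : x ∉ B k := fun hxk =>
        Set.disjoint_left.1 (hd hk) hxk hi
      simp only [hh]
      rw [Finset.sum_eq_single i (fun k _ hk => by simp [hne k hk]) (by simp),
        Finset.sum_eq_single i (fun k _ hk => by simp [hne k hk]) (by simp)]
      simp [hi]
    · push Not at hx
      simp [hh, hx]
  have hint (i) : Integrable ((B i).indicator fun _ => Complex.exp (t i * Complex.I) - 1) ν :=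
    (integrable_const _).indicator (hB i)
  simp_rw [hsub]
  rw [integral_add (integrable_const _) (integrable_finsetSum _ fun i _ => hint i),
    integral_finsetSum _ fun i _ => hint i]
  simp only [integral_indicator_const _ (hB _)]
  simp only [integral_const, probReal_univ, one_smul, add_sub_cancel_left, Complex.real_smul]
  rw [Finset.mul_sum]
  refine Finset.sum_congr rfl fun i _ => ?_
  push_cast; ring

theorem hasLaw_pointCount {B : Set E} (hB : MeasurableSet B) {r : ℝ≥0}
    (hr : (r : ℝ) = c * ν.real B) :
    HasLaw (fun ω => (pointCount B ω : ℝ)) ((poissonMeasure r).map (Nat.cast : ℕ → ℝ))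
      (markedPoisson c ν) := by
  have hm : Measurable fun ω => (pointCount B ω : ℝ) :=
    measurable_from_nat.comp (measurable_pointCount hB)
  refine ⟨hm.aemeasurable, ?_⟩
  have : IsProbabilityMeasure ((markedPoisson c ν).map fun ω => (pointCount B ω : ℝ)) :=
    Measure.isProbabilityMeasure_map hm.aemeasurable
  have : IsProbabilityMeasure ((poissonMeasure r).map (Nat.cast : ℕ → ℝ)) :=
    Measure.isProbabilityMeasure_map (by fun_prop)
  refine Measure.ext_of_charFun (funext fun t => ?_)
  rw [charFun_map_cast_poissonMeasure, charFun_apply, integral_map hm.aemeasurable (by fun_prop)]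
  have := integral_exp_pointCount (c := c) (ν := ν) (ι := Unit) (B := fun _ => B) (fun _ => hB)
    (fun i j hij => (hij rfl).elim) (fun _ => t)
  simp only [Finset.univ_unique, Finset.sum_singleton, Finset.prod_singleton, ← hr] at this
  simp_rw [Real.inner_apply]
  exact this

theorem iIndepFun_pointCount {ι : Type*} [Fintype ι] {B : ι → Set E}
    (hB : ∀ i, MeasurableSet (B i)) (hd : Pairwise (Function.onFun Disjoint B)) :
    iIndepFun (fun i ω => (pointCount (B i) ω : ℝ)) (markedPoisson c ν) := by
  have hm (i) : Measurable fun ω => (pointCount (B i) ω : ℝ) :=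
    measurable_from_nat.comp (measurable_pointCount (hB i))
  rw [iIndepFun_iff_charFun_pi fun i => (hm i).aemeasurable]
  intro t
  have h1 (i) := (hasLaw_pointCount (c := c) (ν := ν) (hB i) (r := c * (ν (B i)).toNNReal)
    (by push_cast; rfl)).map_eq
  simp_rw [h1, charFun_map_cast_poissonMeasure]
  have hmL : Measurable fun ω => WithLp.toLp 2 fun i => (pointCount (B i) ω : ℝ) :=
    (WithLp.measurable_toLp 2 _).comp (measurable_pi_lambda _ hm)
  rw [charFun_apply, integral_map hmL.aemeasurable (by fun_prop)]
  refine Eq.trans ?_ ((integral_exp_pointCount (c := c) (ν := ν) hB hd t).trans ?_)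
  · simp [PiLp.inner_apply, mul_comm]
  · refine Finset.prod_congr rfl fun i _ => ?_
    push_cast
    rfl

end CompoundPoisson

/-! ### Existence of the Poisson random measure -/

section Existence

theorem exists_isProbabilityMeasure_smul_eq {E : Type*} [MeasurableSpace E] [Nonempty E]
    (μ : Measure E) [IsFiniteMeasure μ] :
    ∃ (c : ℝ≥0) (ν : Measure E), IsProbabilityMeasure ν ∧ (c : ℝ≥0∞) • ν = μ := by
  by_cases h : μ = 0
  · obtain ⟨x⟩ := ‹Nonempty E›
    exact ⟨0, Measure.dirac x, inferInstance, by simp [h]⟩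
  · have : NeZero μ := ⟨h⟩
    have h0 : μ Set.univ ≠ 0 := (Measure.measure_univ_ne_zero).2 h
    refine ⟨(μ Set.univ).toNNReal, (μ Set.univ)⁻¹ • μ, inferInstance, ?_⟩
    rw [ENNReal.coe_toNNReal (measure_ne_top _ _), smul_smul,
      ENNReal.mul_inv_cancel h0 (measure_ne_top _ _), one_smul]

theorem iIndepFun_comp_of_map {Ω Ω' ι : Type*} [MeasurableSpace Ω] [MeasurableSpace Ω']
    {β : ι → Type*} [∀ i, MeasurableSpace (β i)] {P : Measure Ω} {g : Ω → Ω'} (hg : Measurable g)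
    {f : ∀ i, Ω' → β i} (hf : ∀ i, Measurable (f i)) (h : iIndepFun f (P.map g)) :
    iIndepFun (fun i ω => f i (g ω)) P := by
  rw [iIndepFun_iff_measure_inter_preimage_eq_mul] at h ⊢
  intro S sets hS
  have hmeas (i) (hi : i ∈ S) : MeasurableSet (f i ⁻¹' sets i) := hf i (hS i hi)
  have := h S hS
  rw [Measure.map_apply hg (S.measurableSet_biInter hmeas),
    Finset.prod_congr rfl fun i hi => Measure.map_apply hg (hmeas i hi)] at this
  simpa [Set.preimage_iInter, Set.preimage_preimage] using this

variable {E : Type*} [TopologicalSpace E] [T2Space E] [LocallyCompactSpace E]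
  [SecondCountableTopology E] [MeasurableSpace E] [BorelSpace E]

/-- Superposition of independent samples on disjoint pieces of finite mass: N(B) is a countable sum
of independent Poisson counts, with parameters summing to lam(B). -/
theorem exists_isPoissonRandomMeasure [Nonempty E] (lam : Measure E)
    [IsLocallyFiniteMeasure lam] :
    ∃ Q : Measure (LocFinMeasure E), IsProbabilityMeasure Q ∧ IsPoissonRandomMeasure lam id Q := by
  let K : CompactExhaustion E := CompactExhaustion.choice E
  let A : ℕ → Set E := disjointed K
  have hAm (k) : MeasurableSet (A k) :=
    MeasurableSet.disjointed (fun i => (K.isCompact i).measurableSet) k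
  have hAd : Pairwise (Function.onFun Disjoint A) := disjoint_disjointed _
  have hAu : ⋃ k, A k = Set.univ := by rw [iUnion_disjointed, K.iUnion_eq]
  have hAfin (k) : lam (A k) < ∞ :=
    (measure_mono (disjointed_subset _ k)).trans_lt (K.isCompact k).measure_lt_top
  have hfin (k) : IsFiniteMeasure (lam.restrict (A k)) :=
    ⟨by rw [Measure.restrict_apply_univ]; exact hAfin k⟩
  choose c ν hν hcν using fun k => exists_isProbabilityMeasure_smul_eq (lam.restrict (A k))
  let P : Measure (ℕ → ℕ × (ℕ → E)) := Measure.infinitePi fun k => markedPoisson (c k) (ν k)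
  let X (B : Set E) (k : ℕ) (ω : ℕ → ℕ × (ℕ → E)) : ℝ≥0∞ := (pointCount (B ∩ A k) (ω k) : ℝ≥0∞)
  have hcount (B : Set E) (hB : MeasurableSet B) (k : ℕ) :
      Measurable fun ω : ℕ × (ℕ → E) => (pointCount (B ∩ A k) ω : ℝ≥0∞) :=
    measurable_from_nat.comp (measurable_pointCount (hB.inter (hAm k)))
  have hXm (B : Set E) (hB : MeasurableSet B) (k : ℕ) : Measurable (X B k) :=
    (hcount B hB k).comp (measurable_pi_apply k)
  -- Sample points need not lie in `A k` for every ω; restricting to `A k` makes local finiteness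
  -- hold everywhere and not just almost surely.
  let N₀ (ω : ℕ → ℕ × (ℕ → E)) : Measure E := Measure.sum fun k =>
    (∑ j ∈ Finset.range (ω k).1, Measure.dirac ((ω k).2 j)).restrict (A k)
  have hN₀ (B : Set E) (hB : MeasurableSet B) (ω) : N₀ ω B = ∑' k, X B k ω := by
    simp only [N₀, X]
    rw [Measure.sum_apply _ hB]
    refine tsum_congr fun k => ?_
    rw [Measure.restrict_apply hB, Measure.finsetSum_apply, pointCount, Nat.cast_sum]
    refine Finset.sum_congr rfl fun j _ => ?_
    rw [Measure.dirac_apply' _ (hB.inter (hAm k))]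
    by_cases hx : (ω k).2 j ∈ B ∩ A k <;> simp [hx]
  have hlf (ω) : IsLocallyFiniteMeasure (N₀ ω) := by
    refine ⟨fun x => ?_⟩
    obtain ⟨n, hn⟩ := K.exists_mem_nhds x
    refine ⟨K n, hn, ?_⟩
    -- The compact set `K n` meets only the pieces `A k` with k ≤ n, so the sum is finite.
    rw [hN₀ _ (K.isCompact n).measurableSet, tsum_eq_sum (s := Finset.range (n + 1))]
    · exact ENNReal.sum_lt_top.2 fun k _ => ENNReal.natCast_lt_top _
    · intro k hk
      have hempty : (K n : Set E) ∩ A k = ∅ := by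
        rw [← Set.disjoint_iff_inter_eq_empty]
        simp only [Finset.mem_range, not_lt] at hk
        refine Set.disjoint_left.2 fun y hy hyA => ?_
        rw [show A k = disjointed K k from rfl, disjointed_eq_inter_compl] at hyA
        exact Set.mem_iInter₂.1 hyA.2 n (by omega) hy
      simp [X, hempty, pointCount]
  let N (ω : ℕ → ℕ × (ℕ → E)) : LocFinMeasure E := ⟨N₀ ω, hlf ω⟩
  have hNm : Measurable N :=
    LocFinMeasure.measurable_of_toMeasure (Measure.measurable_of_measurable_coe _ fun B hB => by
      simp only [N, hN₀ B hB]
      exact Measurable.tsum fun k => hXm B hB k)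
  have heval (k) : P.map (fun ω => ω k) = markedPoisson (c k) (ν k) :=
    Measure.infinitePi_map_eval _ k
  have hcast : ENNReal.ofReal ∘ (Nat.cast : ℕ → ℝ) = (Nat.cast : ℕ → ℝ≥0∞) :=
    funext fun n => ENNReal.ofReal_natCast n
  have hXlaw (B : Set E) (hB : MeasurableSet B) (k : ℕ) : HasLaw (X B k)
      ((poissonMeasure (lam (B ∩ A k)).toNNReal).map (Nat.cast : ℕ → ℝ≥0∞)) P := by
    have hr : (((lam (B ∩ A k)).toNNReal : ℝ≥0) : ℝ) = c k * (ν k).real (B ∩ A k) := by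
      have h := congrArg (fun μ : Measure E => (μ (B ∩ A k)).toReal) (hcν k)
      simp only [Measure.smul_apply, smul_eq_mul, ENNReal.toReal_mul, ENNReal.coe_toReal,
        Measure.restrict_apply (hB.inter (hAm k)), Set.inter_assoc, Set.inter_self] at h
      exact h.symm
    have h1 := hasLaw_pointCount (c := c k) (ν := ν k) (hB.inter (hAm k)) hr
    have h2 : HasLaw ENNReal.ofReal
        ((poissonMeasure (lam (B ∩ A k)).toNNReal).map (Nat.cast : ℕ → ℝ≥0∞))
        ((poissonMeasure (lam (B ∩ A k)).toNNReal).map (Nat.cast : ℕ → ℝ)) :=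
      ⟨ENNReal.measurable_ofReal.aemeasurable, by
        rw [Measure.map_map ENNReal.measurable_ofReal measurable_from_nat, hcast]⟩
    have h3 : HasLaw (fun ω : ℕ → ℕ × (ℕ → E) => ω k) (markedPoisson (c k) (ν k)) P :=
      ⟨(measurable_pi_apply k).aemeasurable, heval k⟩
    have h4 := (h2.comp h1).comp h3
    have h5 : (ENNReal.ofReal ∘ fun ω => (pointCount (B ∩ A k) ω : ℝ)) ∘
        (fun ω : ℕ → ℕ × (ℕ → E) => ω k) = X B k := funext fun ω => ENNReal.ofReal_natCast _
    rwa [h5] at h4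
  have hXind (B : Set E) (hB : MeasurableSet B) : iIndepFun (X B) P :=
    iIndepFun_infinitePi (X := fun k ω => (pointCount (B ∩ A k) ω : ℝ≥0∞)) (hcount B hB)
  have hlaw (B : Set E) (hB : MeasurableSet B) (hBfin : lam B < ∞) :
      HasLaw (fun ω => ∑' k, X B k ω)
        ((poissonMeasure (lam B).toNNReal).map (Nat.cast : ℕ → ℝ≥0∞)) P := by
    refine hasLaw_tsum_poisson (hXm B hB) (hXlaw B hB) (hXind B hB) ?_
    have hsum : lam B = ∑' k, lam (B ∩ A k) := by
      rw [← measure_iUnion (fun i j hij => (hAd hij).mono Set.inter_subset_right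
        Set.inter_subset_right) fun k => hB.inter (hAm k), ← Set.inter_iUnion, hAu, Set.inter_univ]
    have hBk (k) : lam (B ∩ A k) ≠ ∞ :=
      ((measure_mono Set.inter_subset_left).trans_lt hBfin).ne
    rw [← ENNReal.hasSum_coe, ENNReal.coe_toNNReal hBfin.ne]
    simp_rw [ENNReal.coe_toNNReal (hBk _)]
    rw [hsum]
    exact ENNReal.summable.hasSum
  have hindep (m : ℕ) (B : Fin m → Set E) (hB : ∀ i, MeasurableSet (B i))
      (hd : Pairwise fun i j => Disjoint (B i) (B j)) :
      iIndepFun (fun i ω => ∑' k, X (B i) k ω) P := by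
    have h1 : iIndepFun (fun k ω i => X (B i) k ω) P :=
      iIndepFun_infinitePi (X := fun k ω (i : Fin m) => (pointCount (B i ∩ A k) ω : ℝ≥0∞))
        fun k => measurable_pi_lambda _ fun i => hcount (B i) (hB i) k
    have h2 (k : ℕ) : iIndepFun (fun i => X (B i) k) P := by
      have h := iIndepFun_pointCount (c := c k) (ν := ν k) (fun i => (hB i).inter (hAm k))
        (fun i j hij => (hd hij).mono Set.inter_subset_left Set.inter_subset_left)
      have h' := h.comp (fun _ => ENNReal.ofReal) fun _ => ENNReal.measurable_ofReal
      simp only [Function.comp_def, ENNReal.ofReal_natCast] at h'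
      rw [← heval k] at h'
      have hg : Measurable fun ω : ℕ → ℕ × (ℕ → E) => ω k := measurable_pi_apply k
      exact iIndepFun_comp_of_map hg
        (f := fun i ω => (pointCount (B i ∩ A k) ω : ℝ≥0∞)) (fun i => hcount (B i) (hB i) k) h'
    -- Independence across pieces and, within a piece, across the disjoint sets gives independence
    -- over all pairs, which are then regrouped by set.
    have h3 := iIndepFun_uncurry' (X := fun k i => X (B i) k) (fun k i => hXm (B i) (hB i) k) h1 h2
    have h4 : iIndepFun (fun (p : Fin m × ℕ) ω => X (B p.1) p.2 ω) P :=
      h3.precomp (g := Prod.swap) Prod.swap_injective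
    have h5 := iIndepFun_curry (X := fun i k => X (B i) k) (fun i k => hXm (B i) (hB i) k) h4
    exact h5.comp (fun _ x => ∑' k, x k) fun _ => Measurable.tsum fun k => measurable_pi_apply k
  have hPRM : IsPoissonRandomMeasure lam N P := by
    refine ⟨hNm, fun m B hB hd => ?_, fun B hB hBfin => ?_⟩
    · simp only [N, hN₀ _ (hB _)]
      exact hindep m B hB hd
    · simp only [N, hN₀ _ hB]
      exact hlaw B hB hBfin
  exact ⟨P.map N, Measure.isProbabilityMeasure_map hNm.aemeasurable, hPRM.id_map⟩

end Existence

/-! ### Application to the stationary array -/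

section MainTheorem

theorem IsStationaryRow.measure_preimage_eq {Ω E : Type*} [MeasurableSpace Ω] [MeasurableSpace E]
    {n : ℕ} {Y : ℕ → Ω → E} {P : Measure Ω} (h : IsStationaryRow n Y P) {B : Set E}
    (hB : MeasurableSet B) {j : ℕ} (hj : j ∈ Finset.Icc 1 n) :
    P {ω | Y j ω ∈ B} = P {ω | Y 1 ω ∈ B} := by
  rw [Finset.mem_Icc] at hj
  have hid := h 1 (j - 1) (by omega)
  have hB' : MeasurableSet {v : Fin 1 → E | v 0 ∈ B} := measurable_pi_apply 0 hB
  have := hid.measure_mem_eq hB'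
  simp only [Set.preimage_ofPred_eq, Fin.val_zero, zero_add, Nat.add_sub_cancel' hj.1] at this
  exact this.symm

theorem empiricalProcess_apply {Ω E : Type*} [TopologicalSpace E] [MeasurableSpace E] (n : ℕ)
    (Y : ℕ → Ω → E) (ω : Ω) {B : Set E} (hB : MeasurableSet B) :
    (empiricalProcess n Y ω).toMeasure B = ∑ j ∈ Finset.Icc 1 n, B.indicator 1 (Y j ω) := by
  simp only [empiricalProcess, Measure.finsetSum_apply, Measure.dirac_apply' _ hB]

theorem measure_singleton_eq_zero_of_absolutelyContinuous {lam : Measure PosHalfLine}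
    (hac : lam ≪ Measure.comap Subtype.val (volume : Measure ℝ)) (x : PosHalfLine) :
    lam {x} = 0 := by
  refine hac ?_
  rw [(MeasurableEmbedding.subtype_coe measurableSet_Ioi).comap_apply, Set.image_singleton]
  exact Real.volume_singleton

end MainTheorem

theorem mainTheorem4
    {Ω : ℕ → Type*} [∀ n, MeasurableSpace (Ω n)]
    (P : ∀ n, Measure (Ω n)) [∀ n, IsProbabilityMeasure (P n)]
    (X : ∀ n, ℕ → Ω n → PosHalfLine)
    (hX : ∀ n, ∀ j ∈ Finset.Icc 1 n, Measurable (X n j))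
    (hstat : ∀ n, IsStationaryRow n (X n) (P n))
    (lam : Measure PosHalfLine) [IsLocallyFiniteMeasure lam] (hac : lam ≪ Measure.comap Subtype.val (volume : Measure ℝ))
    (hintensity : ∀ I, IsFiniteUnionOpenIntervals I → lam I < ∞ →
      Tendsto (fun n : ℕ => (n : ℝ≥0∞) * P n {ω | X n 1 ω ∈ I}) atTop (𝓝 (lam I)))
    (hpairs : ∀ I, IsFiniteUnionOpenIntervals I → lam I < ∞ →
      ∃ ε : ℝ, 0 < ε ∧ ∃ r : ℕ → ℝ,
        r =o[atTop] (fun n : ℕ => 1 / (n : ℝ) ^ (1 + ε)) ∧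
        ∀ n i j : ℕ, 1 ≤ i → i < j → j ≤ n →
          (P n).real {ω | X n i ω ∈ I ∧ X n j ω ∈ I} ≤ r n)
    (hmixing : ∀ I, IsFiniteUnionOpenIntervals I → lam I < ∞ →
      ∃ θ : ℝ, 0 < θ ∧ θ < 1 ∧ ∃ C : ℝ, 0 < C ∧ ∀ k n q : ℕ, 2 * q + k ≤ n →
        |(P n).real {ω | (∀ j ∈ Finset.Icc 1 q, X n j ω ∈ Iᶜ) ∧
              ∀ j ∈ Finset.Icc (q + k + 1) (2 * q + k), X n j ω ∈ Iᶜ} -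
            ((P n).real {ω | ∀ j ∈ Finset.Icc 1 q, X n j ω ∈ Iᶜ}) ^ 2| ≤ C * θ ^ k) :
    (∃ Q : Measure (LocFinMeasure PosHalfLine),
      IsProbabilityMeasure Q ∧ IsPoissonRandomMeasure lam id Q) ∧
    ∀ {Ω' : Type*} [MeasurableSpace Ω'] (P' : Measure Ω') [IsProbabilityMeasure P']
      (N : Ω' → LocFinMeasure PosHalfLine), IsPoissonRandomMeasure lam N P' →
      TendstoInDistribution (fun n => empiricalProcess n (X n)) atTop N P P' := by
  have hne : Nonempty PosHalfLine := ⟨⟨1, Set.mem_Ioi.2 one_pos⟩⟩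
  refine ⟨exists_isPoissonRandomMeasure lam, fun P' _ N hN => ?_⟩
  refine tendstoInDistribution_of_void (measure_singleton_eq_zero_of_absolutelyContinuous hac)
    (fun n => measurable_empiricalProcess (hX n)) hN (fun n B hB => ae_of_all _ fun ω => ?_)
    (fun I hI hfin => ?_) fun I hI hfin => ?_
  · refine ⟨∑ j ∈ Finset.Icc 1 n, B.indicator 1 (X n j ω), ?_⟩
    rw [empiricalProcess_apply n _ _ hB, Nat.cast_sum]
    refine Finset.sum_congr rfl fun j _ => ?_
    by_cases hx : X n j ω ∈ B <;> simp [hx]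
  · have hIm := hI.isOpen.measurableSet
    obtain ⟨ε, hε, r, hr, hpair⟩ := hpairs I hI hfin
    obtain ⟨θ, hθ0, hθ1, C, hC, hmix⟩ := hmixing I hI hfin
    have hlim : Tendsto (fun n : ℕ => (n : ℝ) * (P n).real {ω | X n 1 ω ∈ I}) atTop
        (𝓝 (lam I).toReal) := by
      have := (ENNReal.tendsto_toReal hfin.ne).comp (hintensity I hI hfin)
      simpa [Function.comp_def, measureReal_def] using this
    have hvoid := tendsto_voidProb (P := P) (A := fun n j => {ω | X n j ω ∈ I})
      (fun n j hj => hX n j hj hIm) (p := fun n => (P n).real {ω | X n 1 ω ∈ I})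
      (fun n j hj => congrArg ENNReal.toReal ((hstat n).measure_preimage_eq hIm hj))
      hlim hε hr hpair hθ0 hθ1 hC hmix
    refine hvoid.congr fun n => ?_
    rw [voidProb]
    congr 1
    ext ω
    simp [empiricalProcess_apply n _ _ hIm]
  -- By stationarity the mean number of points in I is exactly n P(X_{n,1} ∈ I), the quantity in
  -- condition 1.
  · have hIm := hI.isOpen.measurableSet
    refine (hintensity I hI hfin).congr fun n => ?_
    simp_rw [empiricalProcess_apply n _ _ hIm]
    have hm (j) (hj : j ∈ Finset.Icc 1 n) :
        Measurable fun ω => I.indicator (1 : PosHalfLine → ℝ≥0∞) (X n j ω) :=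
      (measurable_one.indicator hIm).comp (hX n j hj)
    rw [lintegral_finsetSum' _ fun j hj => (hm j hj).aemeasurable]
    have hterm (j) (hj : j ∈ Finset.Icc 1 n) :
        ∫⁻ ω, I.indicator (1 : PosHalfLine → ℝ≥0∞) (X n j ω) ∂P n = P n {ω | X n 1 ω ∈ I} := by
      rw [← (hstat n).measure_preimage_eq hIm hj]
      exact lintegral_indicator_one (hX n j hj hIm)
    rw [Finset.sum_congr rfl hterm]
    simp
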